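/- Let $L=(1-\partial_x^2)^{-1}$ be the Fourier multiplier with symbol $\frac{1}{1+\xi^2}$ (equivalently, convolution with $\tfrac12 e^{-|x|}$), and for real-valued $u\in H^1(\mathbb R)$ let $$J(u)=-\frac12\int_{\mathbb R}u\,Lu\,dy-\frac16\int_{\mathbb R}u^3\,dy,\qquad Q(u)=\int_{\mathbb R}u^2\,dy,\qquad \|u\|_{H^1}^2=\int_{\mathbb R}\big(u^2+u_y^2\big)\,dy .$$ For $q,r>0$ put $$V_{q,r}=\{u\in H^1(\mathbb R): Q(u)=q,\ \|u\|_{H^1}<r\}$$ and let $G_q=G_{q,r}$ be the set of minimizers of $J$ over $V_{q,r}$. 1. (Existence.) For small $r$ the set $G_q$ is not empty: for every $\kappa\in(0,1)$ there is $r_0>0$ such that $G_{q,r}\neq\emptyset$ whenever $0<r<r_0$ and $0<q\le\kappa r^2$. (Note that $V_{q,r}$ is empty if $q\ge r^2$.) 2. (Minimizers are solitary waves.) For all $q,r>0$ and every $u\in G_{q,r}$ there is $c\in\mathbb R$ such that $-\frac c2$ is the Lagrange multiplier of $u$, that is, $$J'(u)v=-\frac c2\,Q'(u)v\qquad\text{for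 all } v\in H^1(\mathbb R),$$ and $u$ is a solitary-wave solution with speed $c$ of the Fornberg–Whitham equation $$u_t-u_{txx}+u_x+uu_x=uu_{xxx}+3u_xu_{xx}.$$ The latter means: $u\in H^1(\mathbb R)$ is not identically zero, its continuous representative tends to $0$ at $\pm\infty$, $u$ satisfies the travelling-wave equation $-cu+\frac{u^2}{2}+Lu=0$ weakly on $\mathbb R$, and $U(t,x)=u(x-ct)$ satisfies the Fornberg–Whitham equation in the sense of distributions on $\mathbb R\times\mathbb R$, where the nonlinear terms are understood as $UU_x=(U^2/2)_x$ and $UU_{xxx}+3U_xU_{xx}=(U^2/2)_{xxx}$. -/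

import Mathlib

open MeasureTheory Filter
open scoped ContDiff Topology FourierTransform

noncomputable section

namespace FornbergWhitham

/-! ### The Sobolev space `H¹(ℝ)` of real-valued functions -/

/-- `w` is the weak (distributional) derivative of `u` on the line. -/
def HasWeakDeriv (u w : ℝ → ℝ) : Prop :=
  ∀ φ : ℝ → ℝ, ContDiff ℝ ∞ φ → HasCompactSupport φ →
    ∫ x, u x * deriv φ x = -∫ x, w x * φ x

/-- `u ∈ H¹(ℝ)`: `u` is square integrable and has a square integrable weak derivative. -/
def MemH1 (u : ℝ → ℝ) : Prop :=
  MemLp u 2 ∧ ∃ w : ℝ → ℝ, MemLp w 2 ∧ HasWeakDeriv u w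

open Classical in
/-- The square integrable weak derivative of an `H¹` function (unique almost everywhere);
zero for functions outside `H¹`. -/
def weakDeriv (u : ℝ → ℝ) : ℝ → ℝ :=
  if h : ∃ w : ℝ → ℝ, MemLp w 2 ∧ HasWeakDeriv u w then h.choose else 0

/-- The `H¹` norm. -/
def h1Norm (u : ℝ → ℝ) : ℝ :=
  Real.sqrt ((∫ x, u x ^ 2) + ∫ x, weakDeriv u x ^ 2)

/-! ### The operator `L = (1 - ∂ₓ²)⁻¹` -/

/-- The kernel `e^{-|x|} / 2` of `(1 - ∂ₓ²)⁻¹`. -/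
def kernelL (x : ℝ) : ℝ := (1 / 2) * Real.exp (-|x|)

/-- `L = (1 - ∂ₓ²)⁻¹`, as convolution with its kernel. The two theorems below show that it is
the Fourier multiplier with symbol `1 / (1 + ξ²)`. -/
def opL (u : ℝ → ℝ) (x : ℝ) : ℝ := ∫ y, kernelL (x - y) * u y

theorem integrable_and_fourier_kernelL (ξ : ℝ) :
    (Integrable fun x : ℝ => (kernelL x : ℂ)) ∧
    𝓕 (fun x : ℝ => (kernelL x : ℂ)) ξ = 1 / (1 + (2 * Real.pi * ξ) ^ 2) := by
  have hint : ∀ η : ℝ, IntegrableOn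
      (fun x : ℝ => Complex.exp ((1 - 2 * Real.pi * η * Complex.I) * x)) (Set.Iic 0) ∧
      IntegrableOn
      (fun x : ℝ => Complex.exp ((-1 - 2 * Real.pi * η * Complex.I) * x)) (Set.Ioi 0) := by
    intro η
    constructor
    · exact integrableOn_exp_mul_complex_Iic (by simp) 0
    · exact integrableOn_exp_mul_complex_Ioi (by simp) 0
  have e1 : ∀ η x : ℝ, x ∈ Set.Iic (0 : ℝ) →
      (1 / 2 : ℂ) * Complex.exp ((1 - 2 * Real.pi * η * Complex.I) * x) =
      Complex.exp (((-2 * Real.pi * x * η : ℝ) : ℂ) * Complex.I) • (kernelL x : ℂ) := by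
    intro η x hx
    have hx' : x ≤ 0 := hx
    simp only [kernelL, abs_of_nonpos hx', smul_eq_mul, neg_neg]
    push_cast
    rw [mul_left_comm, ← Complex.exp_add]
    congr 2; ring
  have e2 : ∀ η x : ℝ, x ∈ Set.Ioi (0 : ℝ) →
      (1 / 2 : ℂ) * Complex.exp ((-1 - 2 * Real.pi * η * Complex.I) * x) =
      Complex.exp (((-2 * Real.pi * x * η : ℝ) : ℂ) * Complex.I) • (kernelL x : ℂ) := by
    intro η x hx
    have hx' : 0 < x := hx
    simp only [kernelL, abs_of_pos hx', smul_eq_mul]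
    push_cast
    rw [mul_left_comm, ← Complex.exp_add]
    congr 2; ring
  have i1 : ∀ η : ℝ, IntegrableOn (fun x : ℝ =>
      Complex.exp (((-2 * Real.pi * x * η : ℝ) : ℂ) * Complex.I) • (kernelL x : ℂ))
      (Set.Iic 0) := fun η =>
    IntegrableOn.congr_fun ((hint η).1.const_mul (1 / 2 : ℂ)) (e1 η) measurableSet_Iic
  have i2 : ∀ η : ℝ, IntegrableOn (fun x : ℝ =>
      Complex.exp (((-2 * Real.pi * x * η : ℝ) : ℂ) * Complex.I) • (kernelL x : ℂ))
      (Set.Ioi 0) := fun η =>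
    IntegrableOn.congr_fun ((hint η).2.const_mul (1 / 2 : ℂ)) (e2 η) measurableSet_Ioi
  constructor
  · have h := (i1 0).union (i2 0)
    rw [Set.Iic_union_Ioi, integrableOn_univ] at h
    simpa using h
  · rw [Real.fourier_real_eq_integral_exp_smul, ← intervalIntegral.integral_Iic_add_Ioi (i1 ξ)
      (i2 ξ),
      ← setIntegral_congr_fun measurableSet_Iic (e1 ξ),
      ← setIntegral_congr_fun measurableSet_Ioi (e2 ξ), integral_const_mul, integral_const_mul,
      integral_exp_mul_complex_Iic (by simp), integral_exp_mul_complex_Ioi (by simp)]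
    have h1 : (1 - 2 * Real.pi * ξ * Complex.I : ℂ) ≠ 0 := fun h => by
      simpa using congrArg Complex.re h
    have h2 : (-1 - 2 * Real.pi * ξ * Complex.I : ℂ) ≠ 0 := fun h => by
      simpa using congrArg Complex.re h
    simp only [Complex.ofReal_zero, mul_zero, Complex.exp_zero]
    have h4 : (1 + (2 * Real.pi * ξ) ^ 2 : ℂ) =
        (1 - 2 * Real.pi * ξ * Complex.I) * -(-1 - 2 * Real.pi * ξ * Complex.I) := by
      linear_combination ((2 * Real.pi * ξ : ℂ) ^ 2) * Complex.I_sq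
    rw [h4]
    field_simp
    ring

/-- The kernel of `L` has Fourier transform `1 / (1 + (2πξ)²)`, in the normalization
`∫ e^{-2πixξ} f(x) dx`; that is the symbol `1 / (1 + ξ²)` in the normalization with `e^{-ixξ}`. -/
theorem fourier_kernelL (ξ : ℝ) :
    𝓕 (fun x : ℝ => (kernelL x : ℂ)) ξ = 1 / (1 + (2 * Real.pi * ξ) ^ 2) :=
  (integrable_and_fourier_kernelL ξ).2

/-- `L` is the Fourier multiplier with symbol `1 / (1 + (2πξ)²)`. -/
theorem fourier_opL (u : ℝ → ℝ) (hu : Integrable u) (ξ : ℝ) :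
    𝓕 (fun x : ℝ => (opL u x : ℂ)) ξ =
      1 / (1 + (2 * Real.pi * ξ) ^ 2) * 𝓕 (fun x : ℝ => (u x : ℂ)) ξ := by
  rw [← fourier_kernelL]
  refine Eq.trans ?_
    (Real.fourier_mul_convolution_eq (integrable_and_fourier_kernelL ξ).1 hu.ofReal ξ)
  refine congrArg (fun f : ℝ → ℂ => 𝓕 f ξ) (funext fun x => ?_)
  rw [opL, ← integral_complex_ofReal]
  refine Eq.trans ?_ (convolution_mul_swap (𝕜 := ℂ) (f := fun x : ℝ => (kernelL x : ℂ))
    (g := fun x : ℝ => (u x : ℂ)) (x := x) (μ := volume)).symm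
  simp

/-! ### The variational problem -/

/-- `J(u) = -½ ∫ u Lu - ⅙ ∫ u³`. -/
def J (u : ℝ → ℝ) : ℝ := -(1 / 2) * (∫ y, u y * opL u y) - (1 / 6) * ∫ y, u y ^ 3

/-- `Q(u) = ∫ u²`. -/
def Q (u : ℝ → ℝ) : ℝ := ∫ y, u y ^ 2

/-- The constraint set `V_{q,r} = {u ∈ H¹(ℝ) : Q(u) = q, ‖u‖_{H¹} < r}`. -/
def V (q r : ℝ) : Set (ℝ → ℝ) := {u | MemH1 u ∧ Q u = q ∧ h1Norm u < r}

/-- The set of minimizers of `J` over `V_{q,r}`. -/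
def G (q r : ℝ) : Set (ℝ → ℝ) := {u | u ∈ V q r ∧ IsMinOn J (V q r) u}

/-- `lam` is a Lagrange multiplier at `u` for `J` constrained by `Q`: the directional derivatives
`J'(u)v` and `Q'(u)v` exist and `J'(u)v = lam Q'(u)v`, for every direction `v ∈ H¹(ℝ)`. -/
def IsLagrangeMultiplier (u : ℝ → ℝ) (lam : ℝ) : Prop :=
  ∀ v : ℝ → ℝ, MemH1 v → ∃ dJ dQ : ℝ,
    HasDerivAt (fun ε : ℝ => J (fun y => u y + ε * v y)) dJ 0 ∧
    HasDerivAt (fun ε : ℝ => Q (fun y => u y + ε * v y)) dQ 0 ∧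
    dJ = lam * dQ

/-! ### Solitary waves -/

/-- `U(t, x)` is a distributional solution on `ℝ × ℝ` of the Fornberg–Whitham equation
`U_t - U_txx + U_x + U U_x = U U_xxx + 3 U_x U_xx`. The equation is written in the divergence form
`U_t - U_txx + U_x + (U²/2)_x - (U²/2)_xxx = 0`
(note `(U²/2)_xxx = U U_xxx + 3 U_x U_xx`) and tested against `φ ∈ C_c^∞(ℝ × ℝ)`. -/
def IsWeakSolution (U : ℝ → ℝ → ℝ) : Prop :=
  LocallyIntegrable (fun p : ℝ × ℝ => U p.1 p.2) ∧
  LocallyIntegrable (fun p : ℝ × ℝ => U p.1 p.2 ^ 2) ∧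
  ∀ φ : ℝ → ℝ → ℝ, ContDiff ℝ ∞ (fun p : ℝ × ℝ => φ p.1 p.2) →
    HasCompactSupport (fun p : ℝ × ℝ => φ p.1 p.2) →
    ∫ p : ℝ × ℝ,
      (U p.1 p.2 *
          (deriv (fun s => φ s p.2) p.1
            - iteratedDeriv 2 (fun x => deriv (fun s => φ s x) p.1) p.2
            + deriv (φ p.1) p.2)
        + U p.1 p.2 ^ 2 / 2 * (deriv (φ p.1) p.2 - iteratedDeriv 3 (φ p.1) p.2)) = 0

/-- `u ∈ H¹(ℝ)` is a solitary-wave solution with speed `c`: `u` is not (a.e.) zero, it decays at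
infinity (through its continuous representative), it solves the travelling-wave equation
`-c u + u²/2 + L u = 0` weakly, and `U(t, x) = u(x - ct)` solves the Fornberg–Whitham equation. -/
structure IsSolitaryWave (u : ℝ → ℝ) (c : ℝ) : Prop where
  memH1 : MemH1 u
  nontrivial : ¬ u =ᵐ[volume] 0
  decay : ∃ w : ℝ → ℝ, Continuous w ∧ u =ᵐ[volume] w ∧ Tendsto w (cocompact ℝ) (𝓝 0)
  profile : ∀ φ : ℝ → ℝ, ContDiff ℝ ∞ φ → HasCompactSupport φ →
    ∫ y, (-c * u y + u y ^ 2 / 2 + opL u y) * φ y = 0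
  solution : IsWeakSolution (fun t x => u (x - c * t))

end FornbergWhitham

end

noncomputable section

namespace FornbergWhitham

/-! ### Square integrable functions on the line -/

/-! Existence is a concentration argument in which a linear lower bound for `J` in terms of `Q`
replaces strict subadditivity. Since `0 ≤ L ≤ 1` as a quadratic form and `|∫ u³| ≤ sup |u| · Q u`,
`J` is bounded below on `V q r`. Wide, flat Gaussians of inverse width `β` show that the infimum `I`
lies strictly below `-q/2`: the dispersive loss is of order `β²`, the cubic gain of order `β^(1/2)`
(`exists_mem_V_J_lt`). This strict inequality excludes vanishing (`BddL2.exists_lt_abs`), so a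
translated minimizing sequence `v n` has a subsequence converging weakly and pointwise to some `z ≠
0`, and both `Q` and `J` split asymptotically between `z` and `v n - z`.

The difficulty is the open condition `‖u‖ < r`, which may fail for a rescaled remainder or limit. It
is handled by `exists_smoothing`: if `|v| ≤ M` is small and `J v ≤ -Q v / 2`, then `v` consists
mostly of low frequencies, and the small solution `u` of `c u - u²/2 = L v`, with `c` chosen so that
`Q u = Q v`, satisfies `J u ≤ J v` and `∫ u'² ≤ 2 M Q v`. Multiplying `u` by `√(q / Q v) ≥ 1` only
helps, because `∫ u³ ≥ 0`, and the product lies in `V q r` once `q + 8 r q < r²`. Hence `J v ≥ (Q v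
/ q) I` for all small `v` with `Q v ≤ q` (`div_mul_le_J`). For `v n - z` this yields `J z ≤ (Q z /
q) I` in the limit, and smoothing and rescaling `z` produces a minimizer. Dichotomy need not be
excluded, and strong convergence is not needed.

For the second part, the norm constraint is open, so `a(ε) (u + ε v)`, with `a` restoring `Q = q`,
is admissible for small `ε`; stationarity at `ε = 0` is the Euler–Lagrange equation. The evolution
equation is the sum of `(1 - ∂ₓ²)(U_t + c U_x) = 0` and the `x`-derivative of `1 - ∂ₓ²` applied to
the profile equation. -/

theorem integrable_mul_of_memLp_two {u v : ℝ → ℝ} (hu : MemLp u 2) (hv : MemLp v 2) :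
    Integrable (fun x => u x * v x) :=
  hu.integrable_mul hv

theorem sq_integral_mul_le {u v : ℝ → ℝ} {μ : Measure ℝ} (hu : MemLp u 2 μ) (hv : MemLp v 2 μ) :
    (∫ x, u x * v x ∂μ) ^ 2 ≤ (∫ x, u x ^ 2 ∂μ) * ∫ x, v x ^ 2 ∂μ := by
  have hq : ∀ t : ℝ, 0 ≤ (∫ x, v x ^ 2 ∂μ) * (t * t) + (2 * ∫ x, u x * v x ∂μ) * t
      + ∫ x, u x ^ 2 ∂μ := by
    intro t
    have h1 : 0 ≤ ∫ x, (u x + t * v x) ^ 2 ∂μ := integral_nonneg fun x => sq_nonneg _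
    have h2 : ∫ x, (u x + t * v x) ^ 2 ∂μ = ∫ x, (v x ^ 2 * (t * t) + (2 * (u x * v x)) * t
        + u x ^ 2) ∂μ := by
      congr 1; ext x; ring
    have hi : Integrable (fun x => 2 * (u x * v x) * t) μ :=
      ((hu.integrable_mul hv).const_mul 2).mul_const t
    have hi' : Integrable (fun x => v x ^ 2 * (t * t)) μ := hv.integrable_sq.mul_const _
    have hi'' : Integrable (fun x => v x ^ 2 * (t * t) + 2 * (u x * v x) * t) μ := hi'.add hi
    rw [h2, integral_add hi'' hu.integrable_sq, integral_add hi' hi, integral_mul_const,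
      integral_mul_const, integral_const_mul] at h1
    exact h1
  have := discrim_le_zero hq
  rw [discrim] at this
  nlinarith

theorem MemLp.locallyIntegrable_two {u : ℝ → ℝ} (hu : MemLp u 2) : LocallyIntegrable u :=
  hu.locallyIntegrable (by norm_num)

theorem intervalIntegrable_of_memLp_two {u : ℝ → ℝ} (hu : MemLp u 2) (a b : ℝ) :
    IntervalIntegrable u volume a b :=
  ((MemLp.locallyIntegrable_two hu).integrableOn_isCompact isCompact_uIcc).intervalIntegrable

theorem memLp_two_of_hasCompactSupport {φ : ℝ → ℝ} (hφ : Continuous φ)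
    (hc : HasCompactSupport φ) : MemLp φ 2 :=
  hφ.memLp_of_hasCompactSupport hc

/-! ### Weak derivatives -/

/-- Integrating from a point left of the support, the zero mean makes the primitive vanish again on
the right. -/
theorem exists_hasCompactSupport_primitive {η : ℝ → ℝ} (hη : ContDiff ℝ ∞ η)
    (hc : HasCompactSupport η) (h0 : ∫ x, η x = 0) :
    ∃ Φ : ℝ → ℝ, ContDiff ℝ ∞ Φ ∧ HasCompactSupport Φ ∧ deriv Φ = η := by
  obtain ⟨R, hR⟩ := hc.isCompact.isBounded.subset_closedBall 0
  have hsupp : ∀ x, R < |x| → η x = 0 := by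
    intro x hx
    by_contra h
    have := hR (subset_tsupport _ h)
    simp at this
    linarith
  have hd : ∀ x, HasDerivAt (fun y => ∫ t in (-(|R|+1))..y, η t) (η x) x := fun x =>
    intervalIntegral.integral_hasDerivAt_right (hη.continuous.intervalIntegrable _ _)
      (hη.continuous.stronglyMeasurableAtFilter _ _) hη.continuous.continuousAt
  have hderiv : deriv (fun y => ∫ t in (-(|R|+1))..y, η t) = η := funext fun x => (hd x).deriv
  refine ⟨_, ?_, ?_, hderiv⟩
  · rw [contDiff_infty_iff_deriv, hderiv]
    exact ⟨fun x => (hd x).differentiableAt, hη⟩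
  · refine HasCompactSupport.of_support_subset_isCompact (isCompact_Icc (a := -(|R|+1))
      (b := |R|+1)) ?_
    intro x hx
    by_contra h
    apply hx
    rw [Set.mem_Icc, not_and_or, not_le, not_le] at h
    have hab := le_abs_self R
    rcases h with h | h
    · refine (intervalIntegral.integral_congr (g := fun _ => (0:ℝ)) ?_).trans (by simp)
      intro y hy
      rw [Set.uIcc_of_ge h.le] at hy
      refine hsupp y ?_
      have := neg_abs_le y
      have := neg_le_abs y
      linarith [hy.2]
    · rw [← h0]
      have : ∀ y, y ∉ Set.Ioc (-(|R|+1)) x → η y = 0 := by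
        intro y hy
        apply hsupp
        rw [Set.mem_Ioc, not_and_or, not_lt, not_le] at hy
        have := neg_le_abs y
        have := le_abs_self y
        rcases hy with hy | hy <;> linarith
      simp only
      rw [intervalIntegral.integral_of_le (by linarith [abs_nonneg R])]
      exact setIntegral_eq_integral_of_forall_compl_eq_zero this

/-- The lemma of du Bois-Reymond. -/
theorem exists_ae_eq_const_of_integral_mul_deriv_eq_zero {g : ℝ → ℝ} (hg : LocallyIntegrable g)
    (h : ∀ φ : ℝ → ℝ, ContDiff ℝ ∞ φ → HasCompactSupport φ → ∫ x, g x * deriv φ x = 0) :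
    ∃ C : ℝ, g =ᵐ[volume] fun _ => C := by
  obtain ⟨ψ, hψ, hψc, hψ1⟩ : ∃ ψ : ℝ → ℝ, ContDiff ℝ ∞ ψ ∧ HasCompactSupport ψ ∧
      ∫ x, ψ x = 1 := by
    let b : ContDiffBump (0 : ℝ) := ⟨1, 2, by norm_num, by norm_num⟩
    exact ⟨b.normed volume, b.contDiff_normed, b.hasCompactSupport_normed, b.integral_normed⟩
  have hint : ∀ φ : ℝ → ℝ, ContDiff ℝ ∞ φ → HasCompactSupport φ →
      Integrable (fun x => g x * φ x) := fun φ hφ hφc => by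
    simpa [mul_comm] using hg.integrable_smul_left_of_hasCompactSupport hφ.continuous hφc
  refine ⟨∫ x, g x * ψ x, ?_⟩
  refine ae_eq_of_integral_contDiff_smul_eq hg (locallyIntegrable_const _) fun φ hφ hφc => ?_
  have hφi : Integrable φ := hφ.continuous.integrable_of_hasCompactSupport hφc
  have hψi : Integrable ψ := hψ.continuous.integrable_of_hasCompactSupport hψc
  -- Removing its mean, carried by `ψ`, turns `φ` into the derivative of a test function.
  obtain ⟨Φ, hΦ, hΦc, hΦd⟩ := exists_hasCompactSupport_primitive
    (η := fun x => φ x - (∫ y, φ y) * ψ x) (hφ.sub (contDiff_const.mul hψ))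
    (hφc.sub (hψc.mul_left)) (by
      rw [integral_sub hφi (hψi.const_mul _), integral_const_mul, hψ1]; ring)
  have h1 := h Φ hΦ hΦc
  rw [hΦd] at h1
  have h2 : ∫ x, g x * (φ x - (∫ y, φ y) * ψ x) =
      (∫ x, g x * φ x) - (∫ y, φ y) * ∫ x, g x * ψ x := by
    rw [← integral_const_mul, ← integral_sub (hint φ hφ hφc) ((hint ψ hψ hψc).const_mul _)]
    congr 1; ext x; ring
  rw [h2] at h1
  simp only [smul_eq_mul]
  rw [integral_mul_const]
  simp_rw [mul_comm (φ _)]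
  linarith

theorem HasWeakDeriv.ae_unique {u w w' : ℝ → ℝ} (hw : MemLp w 2) (hw' : MemLp w' 2)
    (h : HasWeakDeriv u w) (h' : HasWeakDeriv u w') : w =ᵐ[volume] w' := by
  refine ae_eq_of_integral_contDiff_smul_eq (MemLp.locallyIntegrable_two hw)
    (MemLp.locallyIntegrable_two hw') fun φ hφ hφc => ?_
  have := h φ hφ hφc
  have := h' φ hφ hφc
  simp only [smul_eq_mul, mul_comm (φ _)]
  linarith

theorem MemH1.weakDeriv_spec {u : ℝ → ℝ} (hu : MemH1 u) :
    MemLp (weakDeriv u) 2 ∧ HasWeakDeriv u (weakDeriv u) := by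
  rw [weakDeriv, dif_pos hu.2]
  exact hu.2.choose_spec

theorem integral_weakDeriv_sq {u w : ℝ → ℝ} (hw : MemLp w 2) (h : HasWeakDeriv u w) :
    ∫ x, weakDeriv u x ^ 2 = ∫ x, w x ^ 2 := by
  have hex : ∃ w : ℝ → ℝ, MemLp w 2 ∧ HasWeakDeriv u w := ⟨w, hw, h⟩
  have : weakDeriv u =ᵐ[volume] w := by
    rw [weakDeriv, dif_pos hex]
    exact HasWeakDeriv.ae_unique hex.choose_spec.1 hw hex.choose_spec.2 h
  exact integral_congr_ae (this.mono fun x hx => by simp only [hx])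

theorem integrable_mul_test {u φ : ℝ → ℝ} (hu : MemLp u 2) (hφ : Continuous φ)
    (hc : HasCompactSupport φ) : Integrable (fun x => u x * φ x) :=
  integrable_mul_of_memLp_two hu (memLp_two_of_hasCompactSupport hφ hc)

theorem memLp_comp_add_right {u : ℝ → ℝ} (hu : MemLp u 2) (a : ℝ) :
    MemLp (fun x => u (x + a)) 2 :=
  hu.comp_measurePreserving (measurePreserving_add_right volume a)

theorem HasWeakDeriv.of_hasDerivAt {u u' : ℝ → ℝ} (hu : ∀ x, HasDerivAt u (u' x) x)
    (hc : Continuous u') : HasWeakDeriv u u' := by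
  intro φ hφ hφc
  have hcu : Continuous u := continuous_iff_continuousAt.2 fun x => (hu x).continuousAt
  have hd : Continuous (deriv φ) := hφ.continuous_deriv (by norm_cast)
  refine integral_mul_deriv_eq_deriv_mul_of_integrable (fun x _ => hu x)
    (fun x _ => (hφ.differentiable (by simp) x).hasDerivAt) ?_ ?_ ?_
  · exact (hcu.mul hd).integrable_of_hasCompactSupport hφc.deriv.mul_left
  · exact (hc.mul hφ.continuous).integrable_of_hasCompactSupport hφc.mul_left
  · exact (hcu.mul hφ.continuous).integrable_of_hasCompactSupport hφc.mul_left

/-- The primitive is only absolutely continuous, with derivative `w` almost everywhere. Integration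
by parts for such functions on an interval reaching beyond the support of `φ` leaves no boundary
terms. -/
theorem HasWeakDeriv.intervalIntegral {w : ℝ → ℝ} (hw : MemLp w 2) :
    HasWeakDeriv (fun x => ∫ t in (0:ℝ)..x, w t) w := by
  intro φ hφ hc
  obtain ⟨R, hR⟩ := hc.isCompact.isBounded.subset_closedBall 0
  set S := |R| + 1
  have hS : 0 < S := by positivity
  have hsupp : ∀ x, x ∉ Set.Ioc (-S) S → φ x = 0 := by
    intro x hx
    by_contra h
    have := hR (subset_tsupport _ h)
    simp at this
    apply hx
    have h1 := abs_le.1 (this.trans (le_abs_self R))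
    exact ⟨by linarith [h1.1], by linarith [h1.2]⟩
  have hsupp' : ∀ x, x ∉ Set.Ioc (-S) S → deriv φ x = 0 := by
    intro x hx
    by_contra h
    have := hR (support_deriv_subset h)
    simp at this
    apply hx
    have h1 := abs_le.1 (this.trans (le_abs_self R))
    exact ⟨by linarith [h1.1], by linarith [h1.2]⟩
  have hwi : IntervalIntegrable w volume (-S) S :=
    intervalIntegrable_of_memLp_two hw _ _
  have hac := hwi.absolutelyContinuousOnInterval_intervalIntegral (c := 0)
    (by rw [Set.uIcc_of_le (by linarith)]; exact ⟨by linarith, by linarith⟩)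
  have hφac : AbsolutelyContinuousOnInterval φ (-S) S :=
    ContDiffOn.absolutelyContinuousOnInterval ((hφ.of_le (by norm_cast)).contDiffOn)
  have key := hac.integral_mul_deriv_eq_deriv_mul hφac
  have b1 : φ (-S) = 0 := hsupp _ (by simp)
  have b2 : φ S = 0 := by
    by_contra h
    have := hR (subset_tsupport _ h)
    simp at this
    have h2 := le_abs_self R
    have h3 := le_abs_self S
    linarith
  rw [b1, b2, mul_zero, mul_zero, sub_zero, zero_sub] at key
  have e2 : ∫ x in (-S)..S, deriv (fun x => ∫ t in (0:ℝ)..x, w t) x * φ x =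
      ∫ x in (-S)..S, w x * φ x := by
    apply intervalIntegral.integral_congr_ae
    filter_upwards [hwi.ae_hasDerivAt_integral] with x hx hx'
    rw [(hx (Set.uIoc_subset_uIcc hx') 0
      (by rw [Set.uIcc_of_le (by linarith)]; exact ⟨by linarith, by linarith⟩)).deriv]
  rw [e2, intervalIntegral.integral_of_le (by linarith), intervalIntegral.integral_of_le
    (by linarith), setIntegral_eq_integral_of_forall_compl_eq_zero,
    setIntegral_eq_integral_of_forall_compl_eq_zero] at key
  · exact key
  · intro x hx; rw [hsupp x hx, mul_zero]
  · intro x hx; rw [hsupp' x hx, mul_zero]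

/-! ### The continuous representative -/

/-- `u` is continuous and is the primitive of `w`, with both square integrable. -/
structure H1Pair (u w : ℝ → ℝ) : Prop where
  memLp : MemLp u 2
  memLp_deriv : MemLp w 2
  sub_eq : ∀ a b, u b - u a = ∫ x in a..b, w x

theorem continuous_intervalIntegral_of_memLp {w : ℝ → ℝ} (hw : MemLp w 2) (a : ℝ) :
    Continuous fun x => ∫ t in a..x, w t :=
  intervalIntegral.continuous_primitive
    (fun _ _ => intervalIntegrable_of_memLp_two hw _ _) a

theorem H1Pair.continuous {u w : ℝ → ℝ} (h : H1Pair u w) : Continuous u := by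
  have : u = fun x => u 0 + ∫ t in (0:ℝ)..x, w t := by
    ext x; rw [← h.sub_eq]; ring
  rw [this]
  exact continuous_const.add (continuous_intervalIntegral_of_memLp h.memLp_deriv 0)

theorem H1Pair.hasWeakDeriv {u w : ℝ → ℝ} (h : H1Pair u w) : HasWeakDeriv u w := by
  intro φ hφ hc
  have hd : Continuous (deriv φ) := hφ.continuous_deriv (by norm_cast)
  have e : (fun x => u x * deriv φ x) =
      fun x => u 0 * deriv φ x + (∫ t in (0:ℝ)..x, w t) * deriv φ x := by
    ext x; rw [← h.sub_eq]; ring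
  have h0 : ∫ x, deriv φ x = 0 := by
    refine integral_eq_zero_of_hasDerivAt_of_integrable (f := φ)
      (fun x => (hφ.differentiable (by simp) x).hasDerivAt)
      (hd.integrable_of_hasCompactSupport hc.deriv)
      (hφ.continuous.integrable_of_hasCompactSupport hc)
  have hi : Integrable fun x => (∫ t in (0:ℝ)..x, w t) * deriv φ x :=
    ((continuous_intervalIntegral_of_memLp h.memLp_deriv 0).mul
      hd).integrable_of_hasCompactSupport hc.deriv.mul_left
  rw [e, integral_add ((hd.integrable_of_hasCompactSupport hc.deriv).const_mul _) hi,
    integral_const_mul, h0, HasWeakDeriv.intervalIntegral h.memLp_deriv φ hφ hc]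
  ring

theorem H1Pair.memH1 {u w : ℝ → ℝ} (h : H1Pair u w) : MemH1 u :=
  ⟨h.memLp, w, h.memLp_deriv, h.hasWeakDeriv⟩

/-- The difference of `u` and a primitive of `w` has zero weak derivative, so it is constant by du
Bois-Reymond. -/
theorem exists_h1Pair {u w : ℝ → ℝ} (hu : MemLp u 2) (hw : MemLp w 2) (h : HasWeakDeriv u w) :
    ∃ v, u =ᵐ[volume] v ∧ H1Pair v w := by
  have hWc := continuous_intervalIntegral_of_memLp hw 0
  obtain ⟨C, hC⟩ := exists_ae_eq_const_of_integral_mul_deriv_eq_zero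
    (g := fun x => u x - ∫ t in (0:ℝ)..x, w t)
    ((MemLp.locallyIntegrable_two hu).sub hWc.locallyIntegrable) (by
      intro φ hφ hc
      have hd : Continuous (deriv φ) := hφ.continuous_deriv (by norm_cast)
      simp_rw [sub_mul]
      have hi : Integrable fun x => (∫ t in (0:ℝ)..x, w t) * deriv φ x :=
        (hWc.mul hd).integrable_of_hasCompactSupport hc.deriv.mul_left
      rw [integral_sub (integrable_mul_test hu hd hc.deriv) hi, h φ hφ hc,
        HasWeakDeriv.intervalIntegral hw φ hφ hc]
      ring)
  have hv : u =ᵐ[volume] fun x => C + ∫ t in (0:ℝ)..x, w t :=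
    hC.mono fun x hx => by simp only at hx; linarith
  refine ⟨_, hv, (memLp_congr_ae hv).1 hu, hw, fun a b => ?_⟩
  have hi : ∀ a b, IntervalIntegrable w volume a b :=
    fun _ _ => intervalIntegrable_of_memLp_two hw _ _
  rw [← intervalIntegral.integral_add_adjacent_intervals (hi 0 a) (hi a b)]
  ring

theorem abs_setIntegral_Icc_le {u : ℝ → ℝ} (hu : MemLp u 2) (x : ℝ) :
    ∫ y in Set.Icc x (x + 1), |u y| ≤ Real.sqrt (∫ y in Set.Icc x (x + 1), u y ^ 2) := by
  apply Real.le_sqrt_of_sq_le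
  have h := sq_integral_mul_le (μ := volume.restrict (Set.Icc x (x + 1))) (u := fun y => |u y|)
    (v := fun _ => 1) (hu.restrict _).abs (memLp_const 1)
  simpa using h

/-- Average `|u x| ≤ |u y| + ∫ |w|` over `y ∈ [x, x + 1]` and use Cauchy–Schwarz. The local form
gives both the uniform bound and the decay at infinity. -/
theorem H1Pair.abs_le {u w : ℝ → ℝ} (h : H1Pair u w) (x : ℝ) :
    |u x| ≤ Real.sqrt (∫ y in Set.Icc x (x + 1), u y ^ 2) +
      Real.sqrt (∫ y in Set.Icc x (x + 1), w y ^ 2) := by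
  have hwl := MemLp.locallyIntegrable_two h.memLp_deriv
  have hwi : IntegrableOn w (Set.Icc x (x + 1)) := hwl.integrableOn_isCompact isCompact_Icc
  have hui : IntegrableOn u (Set.Icc x (x + 1)) :=
    (MemLp.locallyIntegrable_two h.memLp).integrableOn_isCompact isCompact_Icc
  have h1 : ∀ y ∈ Set.Icc x (x + 1), |u x| ≤ |u y| + ∫ t in Set.Icc x (x + 1), |w t| := by
    intro y hy
    have h2 := h.sub_eq x y
    have h3 : |∫ t in x..y, w t| ≤ ∫ t in Set.Icc x (x + 1), |w t| := by
      rw [intervalIntegral.integral_of_le hy.1]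
      refine (abs_integral_le_integral_abs).trans ?_
      refine setIntegral_mono_set hwi.abs (Eventually.of_forall fun t => abs_nonneg _) ?_
      exact LE.le.eventuallyLE
        (Set.Ioc_subset_Icc_self.trans (Set.Icc_subset_Icc_right hy.2))
    rw [← h2] at h3
    have := abs_sub_abs_le_abs_sub (u x) (u y)
    rw [abs_sub_comm] at this
    linarith
  have h4 : ∫ y in Set.Icc x (x + 1), |u x| ≤
      ∫ y in Set.Icc x (x + 1), (|u y| + ∫ t in Set.Icc x (x + 1), |w t|) := by
    refine setIntegral_mono_on (integrableOn_const (by simp)) ?_ measurableSet_Icc h1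
    exact hui.abs.add (integrableOn_const (by simp))
  rw [integral_add hui.abs (integrableOn_const (by simp))] at h4
  simp only [integral_const, smul_eq_mul] at h4
  simp at h4
  linarith [abs_setIntegral_Icc_le h.memLp x, abs_setIntegral_Icc_le h.memLp_deriv x]

theorem H1Pair.abs_le_sqrt_add {u w : ℝ → ℝ} (h : H1Pair u w) (x : ℝ) :
    |u x| ≤ 2 * Real.sqrt ((∫ y, u y ^ 2) + ∫ y, w y ^ 2) := by
  have hle : ∀ v : ℝ → ℝ, MemLp v 2 → ∫ y in Set.Icc x (x + 1), v y ^ 2 ≤ ∫ y, v y ^ 2 :=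
    fun v hv => setIntegral_le_integral hv.integrable_sq (Eventually.of_forall fun y => sq_nonneg _)
  have n1 : 0 ≤ ∫ y, u y ^ 2 := integral_nonneg fun y => sq_nonneg _
  have n2 : 0 ≤ ∫ y, w y ^ 2 := integral_nonneg fun y => sq_nonneg _
  have h1 := Real.sqrt_le_sqrt ((hle u h.memLp).trans (by linarith :
    ∫ y, u y ^ 2 ≤ (∫ y, u y ^ 2) + ∫ y, w y ^ 2))
  have h2 := Real.sqrt_le_sqrt ((hle w h.memLp_deriv).trans (by linarith :
    ∫ y, w y ^ 2 ≤ (∫ y, u y ^ 2) + ∫ y, w y ^ 2))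
  linarith [h.abs_le x]

theorem tendsto_setIntegral_Icc_cocompact {g : ℝ → ℝ} (hg : Integrable g) (hg0 : ∀ x, 0 ≤ g x) :
    Tendsto (fun x => ∫ y in Set.Icc x (x + 1), g y) (cocompact ℝ) (𝓝 0) := by
  rw [cocompact_eq_atBot_atTop]
  refine Tendsto.sup ?_ ?_
  · have h := (tendsto_integral_Iic_zero (f := g) (μ := volume)
      (tendsto_atBot_add_const_right _ 1 tendsto_id : Tendsto (fun x : ℝ => x + 1) atBot atBot))
    refine squeeze_zero (fun x => integral_nonneg fun y => hg0 y) (fun x => ?_) h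
    exact setIntegral_mono_set hg.integrableOn (Eventually.of_forall hg0)
      (LE.le.eventuallyLE Set.Icc_subset_Iic_self)
  · have h := (tendsto_integral_Ici_zero (f := g) (μ := volume) (tendsto_id (α := ℝ)))
    refine squeeze_zero (fun x => integral_nonneg fun y => hg0 y) (fun x => ?_) h
    exact setIntegral_mono_set hg.integrableOn (Eventually.of_forall hg0)
      (LE.le.eventuallyLE Set.Icc_subset_Ici_self)

theorem H1Pair.tendsto_zero {u w : ℝ → ℝ} (h : H1Pair u w) :
    Tendsto u (cocompact ℝ) (𝓝 0) := by
  have h1 := (tendsto_setIntegral_Icc_cocompact h.memLp.integrable_sq fun x => sq_nonneg _).sqrt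
  have h2 := (tendsto_setIntegral_Icc_cocompact h.memLp_deriv.integrable_sq
    fun x => sq_nonneg _).sqrt
  have h3 := h1.add h2
  simp only [Real.sqrt_zero, add_zero] at h3
  exact squeeze_zero_norm (fun x => h.abs_le x) h3

/-! ### The kernel of `L` -/

theorem kernelL_pos (x : ℝ) : 0 < kernelL x := by unfold kernelL; positivity

theorem kernelL_le (x : ℝ) : kernelL x ≤ 1 := by
  have : Real.exp (-|x|) ≤ 1 := Real.exp_le_one_iff.2 (by simp)
  unfold kernelL; linarith

theorem continuous_kernelL : Continuous kernelL := by unfold kernelL; fun_prop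

theorem integrable_kernelL : Integrable kernelL := by
  simpa using (integrable_and_fourier_kernelL 0).1.re

theorem integral_kernelL : ∫ x, kernelL x = 1 := by
  have h := fourier_kernelL 0
  rw [Real.fourier_real_eq_integral_exp_smul] at h
  simp only [mul_zero, Complex.ofReal_zero, zero_mul, Complex.exp_zero, one_smul] at h
  rw [integral_complex_ofReal] at h
  norm_num at h
  exact_mod_cast h

theorem memLp_kernelL : MemLp kernelL 2 := by
  rw [memLp_two_iff_integrable_sq continuous_kernelL.aestronglyMeasurable]
  refine integrable_kernelL.mono' (continuous_kernelL.pow 2).aestronglyMeasurable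
    (Eventually.of_forall fun x => ?_)
  rw [Real.norm_of_nonneg (by positivity)]
  nlinarith [kernelL_pos x, kernelL_le x]

theorem memLp_kernelL_sub (x : ℝ) : MemLp (fun y => kernelL (x - y)) 2 :=
  memLp_kernelL.comp_measurePreserving (Measure.measurePreserving_sub_left volume x)

theorem integrable_kernelL_sub (x : ℝ) : Integrable fun y => kernelL (x - y) :=
  integrable_kernelL.comp_sub_left x

theorem integral_kernelL_sub (x : ℝ) : ∫ y, kernelL (x - y) = 1 := by
  rw [integral_sub_left_eq_self kernelL volume x, integral_kernelL]

theorem integrable_kernelL_mul {u : ℝ → ℝ} (hu : MemLp u 2) (x : ℝ) :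
    Integrable fun y => kernelL (x - y) * u y :=
  integrable_mul_of_memLp_two (memLp_kernelL_sub x) hu

/-! ### Mapping properties of `L` -/

theorem opL_congr {u v : ℝ → ℝ} (h : u =ᵐ[volume] v) : opL u = opL v :=
  funext fun x => integral_congr_ae (h.mono fun y hy => by simp only [hy])

theorem opL_add_const_mul {u v : ℝ → ℝ} (hu : MemLp u 2) (hv : MemLp v 2) (ε : ℝ) (x : ℝ) :
    opL (fun y => u y + ε * v y) x = opL u x + ε * opL v x := by
  unfold opL
  rw [← integral_const_mul, ← integral_add (integrable_kernelL_mul hu x)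
    ((integrable_kernelL_mul hv x).const_mul ε)]
  congr 1; ext y; ring

theorem opL_const_mul (u : ℝ → ℝ) (a : ℝ) (x : ℝ) :
    opL (fun y => a * u y) x = a * opL u x := by
  unfold opL
  rw [← integral_const_mul]
  congr 1; ext y; ring

theorem opL_comp_add_right (u : ℝ → ℝ) (a x : ℝ) :
    opL (fun y => u (y + a)) x = opL u (x + a) := by
  unfold opL
  rw [← integral_add_right_eq_self (fun y => kernelL (x + a - y) * u y) a]
  simp

theorem opL_eq_convolution (g : ℝ → ℝ) :
    opL g = convolution kernelL g (ContinuousLinearMap.mul ℝ ℝ) volume :=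
  funext fun _ => (convolution_mul_swap (𝕜 := ℝ)).symm

theorem integrable_opL {g : ℝ → ℝ} (hg : Integrable g) : Integrable (opL g) := by
  rw [opL_eq_convolution]
  exact integrable_kernelL.integrable_convolution _ hg

theorem integral_opL {g : ℝ → ℝ} (hg : Integrable g) : ∫ x, opL g x = ∫ x, g x := by
  rw [opL_eq_convolution, integral_convolution _ integrable_kernelL hg, integral_kernelL]
  simp

theorem abs_opL_le {u : ℝ → ℝ} {M : ℝ} (hu : MemLp u 2) (h : ∀ x, |u x| ≤ M) (x : ℝ) :
    |opL u x| ≤ M := by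
  refine (abs_integral_le_integral_abs).trans ?_
  have h1 : ∫ y, |kernelL (x - y) * u y| ≤ ∫ y, kernelL (x - y) * M := by
    refine integral_mono (integrable_kernelL_mul hu x).abs
      ((integrable_kernelL_sub x).mul_const M) fun y => ?_
    simp only [abs_mul, abs_of_pos (kernelL_pos _)]
    exact mul_le_mul_of_nonneg_left (h y) (kernelL_pos _).le
  rwa [integral_mul_const, integral_kernelL_sub, one_mul] at h1

/-- Jensen's inequality for the probability density `kernelL (x - ·)`: expand the variance around
`m`. -/
theorem sq_opL_le {u : ℝ → ℝ} (hu : MemLp u 2) (x : ℝ) :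
    opL u x ^ 2 ≤ opL (fun y => u y ^ 2) x := by
  set m := opL u x
  have hi2 : Integrable fun y => kernelL (x - y) * u y ^ 2 := by
    refine hu.integrable_sq.mono' ?_ (Eventually.of_forall fun y => ?_)
    · exact (continuous_kernelL.comp (continuous_const.sub continuous_id)).aestronglyMeasurable.mul
        (hu.aestronglyMeasurable.pow 2)
    · rw [Real.norm_of_nonneg (mul_nonneg (kernelL_pos _).le (sq_nonneg _))]
      nlinarith [kernelL_le (x - y), sq_nonneg (u y)]
  have h1 : 0 ≤ ∫ y, kernelL (x - y) * (u y - m) ^ 2 :=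
    integral_nonneg fun y => mul_nonneg (kernelL_pos _).le (sq_nonneg _)
  have h2 : ∀ y, kernelL (x - y) * (u y - m) ^ 2 = kernelL (x - y) * u y ^ 2
      - (2 * m * (kernelL (x - y) * u y) - m ^ 2 * kernelL (x - y)) := fun y => by ring
  have hi1 := (integrable_kernelL_mul hu x).const_mul (2 * m)
  have hi0 := (integrable_kernelL_sub x).const_mul (m ^ 2)
  have hi3 : Integrable fun y => 2 * m * (kernelL (x - y) * u y) - m ^ 2 * kernelL (x - y) :=
    hi1.sub hi0
  simp_rw [h2] at h1
  rw [integral_sub hi2 hi3, integral_sub hi1 hi0,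
    integral_const_mul, integral_const_mul, integral_kernelL_sub] at h1
  change 0 ≤ opL (fun y => u y ^ 2) x - (2 * m * m - m ^ 2 * 1) at h1
  nlinarith

/-! ### `L` inverts `1 - ∂ₓ²` -/

/-- The derivative of `L u`. -/
def opLDeriv (u : ℝ → ℝ) (x : ℝ) : ℝ :=
  (1 / 2) * (-(Real.exp (-x) * ∫ y in Set.Iic x, Real.exp y * u y) +
    Real.exp x * ∫ y in Set.Ioi x, Real.exp (-y) * u y)

theorem kernelL_sub_of_le {x y : ℝ} (h : y ≤ x) :
    kernelL (x - y) = (1 / 2) * (Real.exp (-x) * Real.exp y) := by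
  rw [kernelL, abs_of_nonneg (by linarith), ← Real.exp_add]; congr 2; ring

theorem kernelL_sub_of_ge {x y : ℝ} (h : x ≤ y) :
    kernelL (x - y) = (1 / 2) * (Real.exp x * Real.exp (-y)) := by
  rw [kernelL, abs_of_nonpos (by linarith), ← Real.exp_add]; congr 2; ring

theorem integrableOn_exp_mul_Iic {u : ℝ → ℝ} (hu : MemLp u 2) (x : ℝ) :
    IntegrableOn (fun y => Real.exp y * u y) (Set.Iic x) := by
  refine IntegrableOn.congr_fun ((integrable_kernelL_mul hu x).const_mul
    (2 * Real.exp x)).integrableOn (fun y hy => ?_) measurableSet_Iic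
  simp only [kernelL_sub_of_le (Set.mem_Iic.1 hy), Real.exp_neg]
  field_simp

theorem integrableOn_exp_neg_mul_Ioi {u : ℝ → ℝ} (hu : MemLp u 2) (x : ℝ) :
    IntegrableOn (fun y => Real.exp (-y) * u y) (Set.Ioi x) := by
  refine IntegrableOn.congr_fun ((integrable_kernelL_mul hu x).const_mul
    (2 * Real.exp (-x))).integrableOn (fun y hy => ?_) measurableSet_Ioi
  simp only [kernelL_sub_of_ge (Set.mem_Ioi.1 hy).le, Real.exp_neg]
  field_simp

theorem opL_eq {u : ℝ → ℝ} (hu : MemLp u 2) (x : ℝ) :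
    opL u x = (1 / 2) * (Real.exp (-x) * (∫ y in Set.Iic x, Real.exp y * u y) +
      Real.exp x * ∫ y in Set.Ioi x, Real.exp (-y) * u y) := by
  have hi := integrable_kernelL_mul hu x
  rw [opL, ← intervalIntegral.integral_Iic_add_Ioi (b := x) hi.integrableOn hi.integrableOn,
    mul_add, ← mul_assoc, ← mul_assoc, ← integral_const_mul, ← integral_const_mul]
  congr 1
  · refine setIntegral_congr_fun measurableSet_Iic fun y hy => ?_
    simp only [kernelL_sub_of_le (Set.mem_Iic.1 hy)]; ring
  · refine setIntegral_congr_fun measurableSet_Ioi fun y hy => ?_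
    simp only [kernelL_sub_of_ge (Set.mem_Ioi.1 hy).le]; ring

theorem hasDerivAt_integral_Iic {u : ℝ → ℝ} (hu : MemLp u 2) (hc : Continuous u) (x : ℝ) :
    HasDerivAt (fun x => ∫ y in Set.Iic x, Real.exp y * u y) (Real.exp x * u x) x := by
  have hcont : Continuous fun y => Real.exp y * u y := Real.continuous_exp.mul hc
  have h : (fun x => ∫ y in Set.Iic x, Real.exp y * u y) = fun x =>
      (∫ y in Set.Iic 0, Real.exp y * u y) + ∫ y in (0:ℝ)..x, Real.exp y * u y := by
    ext x
    rw [← intervalIntegral.integral_Iic_sub_Iic (integrableOn_exp_mul_Iic hu 0)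
      (integrableOn_exp_mul_Iic hu x)]
    ring
  rw [h]
  exact (intervalIntegral.integral_hasDerivAt_right (hcont.intervalIntegrable _ _)
    (hcont.stronglyMeasurableAtFilter _ _) hcont.continuousAt).const_add _

theorem hasDerivAt_integral_Ioi {u : ℝ → ℝ} (hu : MemLp u 2) (hc : Continuous u) (x : ℝ) :
    HasDerivAt (fun x => ∫ y in Set.Ioi x, Real.exp (-y) * u y) (-(Real.exp (-x) * u x)) x := by
  have hcont : Continuous fun y => Real.exp (-y) * u y :=
    (Real.continuous_exp.comp continuous_neg).mul hc
  have h : (fun x => ∫ y in Set.Ioi x, Real.exp (-y) * u y) = fun x =>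
      (∫ y in Set.Ioi 0, Real.exp (-y) * u y) - ∫ y in (0:ℝ)..x, Real.exp (-y) * u y := by
    ext x
    rw [← intervalIntegral.integral_Ioi_sub_Ioi' (integrableOn_exp_neg_mul_Ioi hu 0)
      (integrableOn_exp_neg_mul_Ioi hu x)]
    ring
  rw [h]
  exact (intervalIntegral.integral_hasDerivAt_right (hcont.intervalIntegrable _ _)
    (hcont.stronglyMeasurableAtFilter _ _) hcont.continuousAt).const_sub _

theorem hasDerivAt_opL {u : ℝ → ℝ} (hu : MemLp u 2) (hc : Continuous u) (x : ℝ) :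
    HasDerivAt (opL u) (opLDeriv u x) x := by
  rw [show opL u = _ from funext (opL_eq hu)]
  have h := (((hasDerivAt_neg x).exp.mul (hasDerivAt_integral_Iic hu hc x)).add
    ((Real.hasDerivAt_exp x).mul (hasDerivAt_integral_Ioi hu hc x))).const_mul (1 / 2 : ℝ)
  convert! h using 1
  have : Real.exp (-x) * Real.exp x = 1 := by rw [← Real.exp_add]; simp
  unfold opLDeriv
  linear_combination (0 : ℝ) * this

/-- The boundary terms at `y = x`, which cancel in the derivative of `opL u`, now add up to `-u x`.
-/
theorem hasDerivAt_opLDeriv {u : ℝ → ℝ} (hu : MemLp u 2) (hc : Continuous u) (x : ℝ) :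
    HasDerivAt (opLDeriv u) (opL u x - u x) x := by
  have h := ((((hasDerivAt_neg x).exp.mul (hasDerivAt_integral_Iic hu hc x)).neg).add
    ((Real.hasDerivAt_exp x).mul (hasDerivAt_integral_Ioi hu hc x))).const_mul (1 / 2 : ℝ)
  convert! h using 1
  have : Real.exp (-x) * Real.exp x = 1 := by rw [← Real.exp_add]; simp
  rw [opL_eq hu]
  linear_combination u x * this

theorem abs_opLDeriv_le {u : ℝ → ℝ} (hu : MemLp u 2) (x : ℝ) :
    |opLDeriv u x| ≤ opL (fun y => |u y|) x := by
  rw [opL_eq (u := fun y => |u y|) hu.abs, opLDeriv, abs_mul,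
    abs_of_pos (by norm_num : (0:ℝ) < 1 / 2)]
  refine mul_le_mul_of_nonneg_left ?_ (by norm_num)
  refine (abs_add_le _ _).trans ?_
  rw [abs_neg, abs_mul, abs_mul, Real.abs_exp, Real.abs_exp]
  refine add_le_add (mul_le_mul_of_nonneg_left ?_ (Real.exp_pos _).le)
    (mul_le_mul_of_nonneg_left ?_ (Real.exp_pos _).le)
  · refine abs_integral_le_integral_abs.trans_eq ?_
    simp_rw [abs_mul, Real.abs_exp]
  · refine abs_integral_le_integral_abs.trans_eq ?_
    simp_rw [abs_mul, Real.abs_exp]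

/-- Continuous, bounded and square integrable functions. -/
structure BddL2 (u : ℝ → ℝ) : Prop where
  memLp : MemLp u 2
  continuous : Continuous u
  bdd : ∃ M, ∀ x, |u x| ≤ M

theorem BddL2.abs {u : ℝ → ℝ} (h : BddL2 u) : BddL2 fun x => |u x| :=
  ⟨h.memLp.abs, h.continuous.abs, by simpa using h.bdd⟩

theorem BddL2.continuous_opL {u : ℝ → ℝ} (h : BddL2 u) : Continuous (opL u) :=
  continuous_iff_continuousAt.2 fun x => (hasDerivAt_opL h.memLp h.continuous x).continuousAt

theorem BddL2.continuous_opLDeriv {u : ℝ → ℝ} (h : BddL2 u) : Continuous (opLDeriv u) :=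
  continuous_iff_continuousAt.2 fun x => (hasDerivAt_opLDeriv h.memLp h.continuous x).continuousAt

theorem BddL2.memLp_opL {u : ℝ → ℝ} (h : BddL2 u) : MemLp (opL u) 2 := by
  rw [memLp_two_iff_integrable_sq h.continuous_opL.aestronglyMeasurable]
  refine (integrable_opL h.memLp.integrable_sq).mono'
    (h.continuous_opL.pow 2).aestronglyMeasurable (Eventually.of_forall fun x => ?_)
  rw [Real.norm_of_nonneg (sq_nonneg _)]
  exact sq_opL_le h.memLp x

theorem BddL2.memLp_opLDeriv {u : ℝ → ℝ} (h : BddL2 u) : MemLp (opLDeriv u) 2 :=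
  h.abs.memLp_opL.mono h.continuous_opLDeriv.aestronglyMeasurable
    (Eventually.of_forall fun x => (abs_opLDeriv_le h.memLp x).trans (le_abs_self _))

/-! ### Quadratic identities for `L` -/

theorem BddL2.integral_opL_mul_sub {u v : ℝ → ℝ} (hu : BddL2 u) (hv : BddL2 v) :
    ∫ x, opL v x * (opL u x - u x) = -∫ x, opLDeriv v x * opLDeriv u x :=
  integral_mul_deriv_eq_deriv_mul_of_integrable
    (fun x _ => hasDerivAt_opL hv.memLp hv.continuous x)
    (fun x _ => hasDerivAt_opLDeriv hu.memLp hu.continuous x)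
    (integrable_mul_of_memLp_two hv.memLp_opL (hu.memLp_opL.sub hu.memLp))
    (integrable_mul_of_memLp_two hv.memLp_opLDeriv hu.memLp_opLDeriv)
    (integrable_mul_of_memLp_two hv.memLp_opL hu.memLp_opLDeriv)

theorem BddL2.integral_mul_opL {u v : ℝ → ℝ} (hu : BddL2 u) (hv : BddL2 v) :
    ∫ x, u x * opL v x =
      (∫ x, opL v x * opL u x) + ∫ x, opLDeriv v x * opLDeriv u x := by
  have h := hu.integral_opL_mul_sub hv
  have e : ∀ x, opL v x * (opL u x - u x) = opL v x * opL u x - u x * opL v x := fun x => by ring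
  simp_rw [e] at h
  rw [integral_sub (integrable_mul_of_memLp_two hv.memLp_opL hu.memLp_opL)
    (integrable_mul_of_memLp_two hu.memLp hv.memLp_opL)] at h
  linarith

theorem BddL2.integral_mul_opL_comm {u v : ℝ → ℝ} (hu : BddL2 u) (hv : BddL2 v) :
    ∫ x, u x * opL v x = ∫ x, v x * opL u x := by
  rw [hu.integral_mul_opL hv, hv.integral_mul_opL hu]
  simp_rw [mul_comm]

theorem BddL2.integral_mul_opL_self {u : ℝ → ℝ} (hu : BddL2 u) :
    ∫ x, u x * opL u x = (∫ x, opL u x ^ 2) + ∫ x, opLDeriv u x ^ 2 := by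
  rw [hu.integral_mul_opL hu]
  simp_rw [sq]

theorem BddL2.integral_mul_opL_nonneg {u : ℝ → ℝ} (hu : BddL2 u) :
    0 ≤ ∫ x, u x * opL u x := by
  rw [hu.integral_mul_opL_self]
  exact add_nonneg (integral_nonneg fun x => sq_nonneg _) (integral_nonneg fun x => sq_nonneg _)

/-- This is `(1 + ξ²)² = 1 + 2ξ² + ξ⁴` in physical space: with `f = L u`, `u = f - f''`. Compared
with `BddL2.integral_mul_opL_self`, it shows that `Q u - ∫ u L u` is `∫ f'² + ∫ f''²`, the quantity
that smoothing controls. -/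
theorem BddL2.integral_sq {u : ℝ → ℝ} (hu : BddL2 u) :
    ∫ x, u x ^ 2 = (∫ x, opL u x ^ 2) + 2 * (∫ x, opLDeriv u x ^ 2) +
      ∫ x, (opL u x - u x) ^ 2 := by
  have h := hu.integral_opL_mul_sub hu
  simp_rw [← sq] at h
  have hs : MemLp (fun x => opL u x - u x) 2 := hu.memLp_opL.sub hu.memLp
  have e : ∀ x, u x ^ 2 = opL u x ^ 2 - 2 * (opL u x * (opL u x - u x)) +
      (opL u x - u x) ^ 2 := fun x => by ring
  have hi := (integrable_mul_of_memLp_two hu.memLp_opL hs).const_mul 2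
  have hi' : Integrable fun x => opL u x ^ 2 - 2 * (opL u x * (opL u x - u x)) :=
    hu.memLp_opL.integrable_sq.sub hi
  simp_rw [e]
  rw [integral_add hi' hs.integrable_sq, integral_sub hu.memLp_opL.integrable_sq hi,
    integral_const_mul, h]
  ring

theorem BddL2.integral_mul_opL_le {u : ℝ → ℝ} (hu : BddL2 u) :
    ∫ x, u x * opL u x ≤ ∫ x, u x ^ 2 := by
  rw [hu.integral_mul_opL_self, hu.integral_sq]
  have h1 : 0 ≤ ∫ x, opLDeriv u x ^ 2 := integral_nonneg fun x => sq_nonneg _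
  have h2 : 0 ≤ ∫ x, (opL u x - u x) ^ 2 := integral_nonneg fun x => sq_nonneg _
  linarith

theorem BddL2.add_const_mul {u v : ℝ → ℝ} (hu : BddL2 u) (hv : BddL2 v) (ε : ℝ) :
    BddL2 fun x => u x + ε * v x := by
  obtain ⟨M, hM⟩ := hu.bdd
  obtain ⟨N, hN⟩ := hv.bdd
  refine ⟨hu.memLp.add (hv.memLp.const_mul ε),
    hu.continuous.add (continuous_const.mul hv.continuous), M + |ε| * N, fun x => ?_⟩
  refine (abs_add_le _ _).trans (add_le_add (hM x) ?_)
  rw [abs_mul]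
  exact mul_le_mul_of_nonneg_left (hN x) (abs_nonneg _)

theorem BddL2.mul {u v : ℝ → ℝ} (hu : BddL2 u) (hv : BddL2 v) : BddL2 fun x => u x * v x := by
  obtain ⟨M, hM⟩ := hu.bdd
  obtain ⟨N, hN⟩ := hv.bdd
  refine ⟨?_, hu.continuous.mul hv.continuous, M * N, fun x => ?_⟩
  · refine (hv.memLp.const_mul M).mono
      (hu.continuous.mul hv.continuous).aestronglyMeasurable (Eventually.of_forall fun x => ?_)
    simp only [norm_mul, Real.norm_eq_abs]
    exact mul_le_mul_of_nonneg_right ((hM x).trans (le_abs_self M)) (abs_nonneg _)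
  · rw [abs_mul]
    exact mul_le_mul (hM x) (hN x) (abs_nonneg _) ((abs_nonneg _).trans (hM x))

theorem BddL2.integrable_mul {u v : ℝ → ℝ} (hu : BddL2 u) (hv : BddL2 v) :
    Integrable fun x => u x * v x :=
  integrable_mul_of_memLp_two hu.memLp hv.memLp

theorem BddL2.integrable_mul_opL {u v : ℝ → ℝ} (hu : BddL2 u) (hv : BddL2 v) :
    Integrable fun x => u x * opL v x :=
  integrable_mul_of_memLp_two hu.memLp hv.memLp_opL

theorem BddL2.integrable_cube {u : ℝ → ℝ} (hu : BddL2 u) : Integrable fun x => u x ^ 3 := by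
  refine ((hu.mul hu).integrable_mul hu).congr (Eventually.of_forall fun x => ?_)
  simp only; ring

theorem BddL2.abs_integral_cube_le {u : ℝ → ℝ} (hu : BddL2 u) {M : ℝ} (hM : ∀ x, |u x| ≤ M) :
    |∫ x, u x ^ 3| ≤ M * ∫ x, u x ^ 2 := by
  refine abs_integral_le_integral_abs.trans ?_
  rw [← integral_const_mul]
  refine integral_mono hu.integrable_cube.abs (hu.memLp.integrable_sq.const_mul M) fun x => ?_
  simp only [abs_pow]
  rw [← sq_abs (u x)]
  nlinarith [hM x, sq_nonneg |u x|]

theorem H1Pair.bddL2 {u w : ℝ → ℝ} (h : H1Pair u w) : BddL2 u :=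
  ⟨h.memLp, h.continuous, _, h.abs_le_sqrt_add⟩

/-! ### Smoothing

A function that does better than `-Q / 2` can be replaced by one with the same `Q`, no larger `J`
and a small derivative: solve `c u - u² / 2 = L v` for `u`, with `c` fixed by the value of `Q`. -/

/-- The small solution `u` of `c u - u² / 2 = f`. -/
def smallRoot (c f : ℝ) : ℝ := c - Real.sqrt (c ^ 2 - 2 * f)

/-- The thresholds keep the discriminant at least `1/4 - 1/16 = 3/16`, away from the singularity of
the square root. -/
theorem sqrt_bounds {c f : ℝ} (hc : 1 / 2 ≤ c) (hf : |f| ≤ 1 / 32) :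
    2 / 5 ≤ Real.sqrt (c ^ 2 - 2 * f) ∧ Real.sqrt (c ^ 2 - 2 * f) ^ 2 = c ^ 2 - 2 * f ∧
      3 / 16 ≤ c ^ 2 - 2 * f := by
  have h := abs_le.1 hf
  have h1 : 3 / 16 ≤ c ^ 2 - 2 * f := by nlinarith
  refine ⟨Real.le_sqrt_of_sq_le (by linarith), Real.sq_sqrt (by linarith), h1⟩

theorem smallRoot_spec {c f : ℝ} (hc : 1 / 2 ≤ c) (hf : |f| ≤ 1 / 32) :
    c * smallRoot c f - smallRoot c f ^ 2 / 2 = f := by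
  obtain ⟨-, h, -⟩ := sqrt_bounds hc hf
  unfold smallRoot
  linear_combination (-1 / 2 : ℝ) * h

/-- Rationalization, `(c - s)(c + s) = 2f`; two-sided bounds on the small root then follow from
bounds on `c + s`. -/
theorem abs_smallRoot_mul {c f : ℝ} (hc : 1 / 2 ≤ c) (hf : |f| ≤ 1 / 32) :
    |smallRoot c f| * (c + Real.sqrt (c ^ 2 - 2 * f)) = 2 * |f| := by
  obtain ⟨-, h, -⟩ := sqrt_bounds hc hf
  have hs := Real.sqrt_nonneg (c ^ 2 - 2 * f)
  rw [← abs_of_nonneg (by linarith : 0 ≤ c + Real.sqrt (c ^ 2 - 2 * f)), ← abs_mul,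
    ← abs_of_pos (by norm_num : (0:ℝ) < 2), ← abs_mul, abs_of_pos (by norm_num : (0:ℝ) < 2)]
  congr 1
  unfold smallRoot
  linear_combination -h

theorem abs_smallRoot_le {c f : ℝ} (hc : 1 / 2 ≤ c) (hf : |f| ≤ 1 / 32) :
    |smallRoot c f| ≤ 3 * |f| := by
  have h := abs_smallRoot_mul hc hf
  obtain ⟨h1, -, -⟩ := sqrt_bounds hc hf
  nlinarith [abs_nonneg (smallRoot c f)]

theorem abs_smallRoot_two_le {f : ℝ} (hf : |f| ≤ 1 / 32) : |smallRoot 2 f| ≤ |f| := by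
  have h := abs_smallRoot_mul (c := 2) (by norm_num) hf
  obtain ⟨h1, -, -⟩ := sqrt_bounds (c := 2) (by norm_num) hf
  linarith [mul_nonneg (abs_nonneg (smallRoot 2 f)) ((by norm_num : (0:ℝ) ≤ 2 / 5).trans h1)]

theorem le_sq_smallRoot_half {f : ℝ} (hf : |f| ≤ 1 / 32) : 3 * f ^ 2 ≤ smallRoot (1 / 2) f ^ 2 := by
  have h := abs_smallRoot_mul (c := 1 / 2) le_rfl hf
  obtain ⟨h1, h2, -⟩ := sqrt_bounds (c := 1 / 2) le_rfl hf
  set s := Real.sqrt ((1 / 2) ^ 2 - 2 * f)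
  have hs : s ≤ 3 / 5 := by
    have := abs_le.1 hf
    nlinarith
  rw [← sq_abs f, ← sq_abs (smallRoot _ _)]
  set t := |smallRoot (1 / 2) f|
  have ht : 0 ≤ t := abs_nonneg _
  have : |f| ≤ 11 / 20 * t := by nlinarith
  nlinarith [abs_nonneg f]

theorem continuous_smallRoot : Continuous fun p : ℝ × ℝ => smallRoot p.1 p.2 := by
  unfold smallRoot; fun_prop

theorem hasDerivAt_smallRoot_comp {f : ℝ → ℝ} {f' c x : ℝ} (hc : 1 / 2 ≤ c) (hf : |f x| ≤ 1 / 32)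
    (h : HasDerivAt f f' x) : HasDerivAt (fun y => smallRoot c (f y))
      (f' / Real.sqrt (c ^ 2 - 2 * f x)) x := by
  obtain ⟨h1, -, h3⟩ := sqrt_bounds hc hf
  have := (((h.const_mul 2).const_sub (c ^ 2)).sqrt (by linarith)).const_sub c
  convert! this using 1
  field_simp

/-- Intermediate values in `c`: the squared root is at most `f²` at `c = 2` and at least `3 f²` at
`c = 1/2`. -/
theorem exists_integral_smallRoot_sq_eq {f : ℝ → ℝ} (hf : Continuous f) (hf2 : MemLp f 2)
    (hb : ∀ x, |f x| ≤ 1 / 32) {s : ℝ} (h1 : ∫ x, f x ^ 2 ≤ s) (h2 : s ≤ 3 * ∫ x, f x ^ 2) :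
    ∃ c : ℝ, 1 / 2 ≤ c ∧ c ≤ 2 ∧ ∫ x, smallRoot c (f x) ^ 2 = s := by
  have hcc : ∀ c : ℝ, Continuous fun x => smallRoot c (f x) := fun c =>
    continuous_smallRoot.comp (continuous_const.prodMk hf)
  have hbd : ∀ c ∈ Set.Icc (1 / 2 : ℝ) 2, ∀ x, ‖smallRoot c (f x) ^ 2‖ ≤ 9 * f x ^ 2 := by
    intro c hc x
    have := abs_smallRoot_le hc.1 (hb x)
    rw [Real.norm_of_nonneg (sq_nonneg _), ← sq_abs, ← sq_abs (f x)]
    nlinarith [abs_nonneg (smallRoot c (f x))]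
  have hi : ∀ c ∈ Set.Icc (1 / 2 : ℝ) 2, Integrable fun x => smallRoot c (f x) ^ 2 := fun c hc =>
    (hf2.integrable_sq.const_mul 9).mono' ((hcc c).pow 2).aestronglyMeasurable
      (Eventually.of_forall (hbd c hc))
  have hcont : ContinuousOn (fun c => ∫ x, smallRoot c (f x) ^ 2) (Set.Icc (1 / 2) 2) := by
    refine continuousOn_of_dominated (bound := fun x => 9 * f x ^ 2)
      (fun c _ => ((hcc c).pow 2).aestronglyMeasurable)
      (fun c hc => Eventually.of_forall (hbd c hc)) (hf2.integrable_sq.const_mul 9)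
      (Eventually.of_forall fun x => ?_)
    exact ((continuous_smallRoot.comp (continuous_id.prodMk continuous_const)).pow 2).continuousOn
  have hmem : s ∈ Set.Icc (∫ x, smallRoot 2 (f x) ^ 2) (∫ x, smallRoot (1 / 2) (f x) ^ 2) := by
    constructor
    · refine le_trans (integral_mono (hi 2 ⟨by norm_num, le_rfl⟩) hf2.integrable_sq fun x => ?_) h1
      exact sq_le_sq.2 (abs_smallRoot_two_le (hb x))
    · refine h2.trans ?_
      rw [← integral_const_mul]
      exact integral_mono (hf2.integrable_sq.const_mul 3) (hi _ ⟨le_rfl, by norm_num⟩)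
        fun x => le_sq_smallRoot_half (hb x)
  obtain ⟨c, hc, h⟩ := intermediate_value_Icc' (by norm_num : (1 / 2 : ℝ) ≤ 2) hcont hmem
  exact ⟨c, hc.1, hc.2, h⟩

/-! ### Comparison of `J` with its linearization, and the smoothed competitor -/

theorem BddL2.integral_add_mul_opL_add {u v : ℝ → ℝ} (hu : BddL2 u) (hv : BddL2 v) (ε : ℝ) :
    ∫ x, (u x + ε * v x) * opL (fun y => u y + ε * v y) x = (∫ x, u x * opL u x) +
      2 * ε * (∫ x, v x * opL u x) + ε ^ 2 * ∫ x, v x * opL v x := by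
  have e : ∀ x, (u x + ε * v x) * opL (fun y => u y + ε * v y) x =
      u x * opL u x + (ε * (u x * opL v x) + (ε * (v x * opL u x) + ε ^ 2 * (v x * opL v x))) :=
    fun x => by rw [opL_add_const_mul hu.memLp hv.memLp]; ring
  simp_rw [e]
  have i1 := hu.integrable_mul_opL hu
  have i2 := (hu.integrable_mul_opL hv).const_mul ε
  have i3 := (hv.integrable_mul_opL hu).const_mul ε
  have i4 := (hv.integrable_mul_opL hv).const_mul (ε ^ 2)
  have i34 : Integrable fun x => ε * (v x * opL u x) + ε ^ 2 * (v x * opL v x) := i3.add i4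
  have i234 : Integrable fun x => ε * (u x * opL v x) +
    (ε * (v x * opL u x) + ε ^ 2 * (v x * opL v x)) := i2.add i34
  rw [integral_add i1 i234, integral_add i2 i34, integral_add i3 i4, integral_const_mul,
    integral_const_mul, integral_const_mul, hu.integral_mul_opL_comm hv]
  ring

/-- Positivity of `L` on `v - u`; hence the concave part `-½ ∫ u L u` of `J` lies below its
tangents. -/
theorem BddL2.two_mul_integral_mul_opL_le {u v : ℝ → ℝ} (hu : BddL2 u) (hv : BddL2 v) :
    2 * ∫ x, u x * opL v x ≤ (∫ x, u x * opL u x) + ∫ x, v x * opL v x := by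
  have h := (hv.add_const_mul hu (-1)).integral_mul_opL_nonneg
  rw [hv.integral_add_mul_opL_add hu] at h
  linarith

/-- Minimizing the linearization of `J` at `v` subject to the constraint does not increase `J`. -/
theorem J_le_of_linearized {u v : ℝ → ℝ} (hu : BddL2 u) (hv : BddL2 v) {c : ℝ}
    (hQ : Q u = Q v) (heq : ∀ x, c * u x - u x ^ 2 / 2 = opL v x)
    (hle : ∀ x, v x + 2 * u x ≤ 3 * c) : J u ≤ J v := by
  -- The cubic `h(s) = c s²/2 - s³/6 - s L v(x)` is critical at `u x`, and `h(v) - h(u) = (v - u)²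
  -- (3c - v - 2u) / 6`.
  have hp : ∀ x, c / 2 * u x ^ 2 + (-(1 / 6) * u x ^ 3 - u x * opL v x) ≤
      c / 2 * v x ^ 2 + (-(1 / 6) * v x ^ 3 - v x * opL v x) := by
    intro x
    rw [← heq x]
    nlinarith [mul_nonneg (sq_nonneg (v x - u x)) (sub_nonneg.2 (hle x))]
  have hi : ∀ z, BddL2 z → Integrable fun x => -(1 / 6) * z x ^ 3 - z x * opL v x := fun z hz =>
    (hz.integrable_cube.const_mul _).sub (hz.integrable_mul_opL hv)
  have h1 := integral_mono ((hu.memLp.integrable_sq.const_mul (c / 2)).add (hi u hu))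
    ((hv.memLp.integrable_sq.const_mul (c / 2)).add (hi v hv)) hp
  simp only [Pi.add_apply] at h1
  rw [integral_add (hu.memLp.integrable_sq.const_mul (c / 2)) (hi u hu),
    integral_add (hv.memLp.integrable_sq.const_mul (c / 2)) (hi v hv),
    integral_sub (hu.integrable_cube.const_mul _) (hu.integrable_mul_opL hv),
    integral_sub (hv.integrable_cube.const_mul _) (hv.integrable_mul_opL hv),
    integral_const_mul, integral_const_mul, integral_const_mul, integral_const_mul] at h1
  unfold Q at hQ
  rw [hQ] at h1
  have h2 := hu.two_mul_integral_mul_opL_le hv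
  unfold J
  linarith

/-- The hypothesis on `J` says `Q v - ∫ v L v ≤ ⅓ ∫ v³ ≤ M Q v / 3`. So `L v` carries nearly all of
the mass, which makes `c` available, and `∫ (L v)'² ≤ M Q v / 3`; being a smooth function of `L v`,
the root inherits such a bound. -/
theorem exists_smoothing {v : ℝ → ℝ} (hv : BddL2 v) {M : ℝ} (hM : ∀ x, |v x| ≤ M)
    (hM' : M ≤ 1 / 32) (hJ : J v ≤ -(Q v / 2)) :
    ∃ u w, H1Pair u w ∧ Q u = Q v ∧ J u ≤ J v ∧ ∫ x, w x ^ 2 ≤ 2 * M * Q v := by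
  have hM0 : 0 ≤ M := (abs_nonneg _).trans (hM 0)
  have hfb : ∀ x, |opL v x| ≤ 1 / 32 := fun x => (abs_opL_le hv.memLp hM x).trans hM'
  have hcube := (le_abs_self _).trans (hv.abs_integral_cube_le hM)
  have hself := hv.integral_mul_opL_self
  have hsq := hv.integral_sq
  have hd1 : 0 ≤ ∫ x, opLDeriv v x ^ 2 := integral_nonneg fun x => sq_nonneg _
  have hd2 : 0 ≤ ∫ x, (opL v x - v x) ^ 2 := integral_nonneg fun x => sq_nonneg _
  have hQ0 : 0 ≤ Q v := integral_nonneg fun x => sq_nonneg _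
  unfold J Q at hJ
  change _ ≤ M * Q v at hcube
  change Q v = _ at hsq
  change _ ≤ -(Q v / 2) at hJ
  have hMQ : M * Q v ≤ 1 / 32 * Q v := mul_le_mul_of_nonneg_right hM' hQ0
  obtain ⟨c, hc1, hc2, hcQ⟩ := exists_integral_smallRoot_sq_eq hv.continuous_opL hv.memLp_opL hfb
    (s := Q v) (by linarith) (by linarith)
  have hder := fun x => hasDerivAt_smallRoot_comp hc1 (hfb x)
    (hasDerivAt_opL hv.memLp hv.continuous x)
  have huc : Continuous fun x => smallRoot c (opL v x) :=
    continuous_iff_continuousAt.2 fun x => (hder x).continuousAt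
  have hsc : Continuous fun x => Real.sqrt (c ^ 2 - 2 * opL v x) := by
    have := hv.continuous_opL
    fun_prop
  have hwc : Continuous fun x => opLDeriv v x / Real.sqrt (c ^ 2 - 2 * opL v x) :=
    hv.continuous_opLDeriv.div hsc fun x => by
      have := (sqrt_bounds hc1 (hfb x)).1
      linarith
  have hu2 : MemLp (fun x => smallRoot c (opL v x)) 2 := by
    refine (hv.memLp_opL.const_mul 3).mono huc.aestronglyMeasurable
      (Eventually.of_forall fun x => ?_)
    rw [norm_mul, Real.norm_eq_abs, Real.norm_eq_abs, Real.norm_eq_abs,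
      abs_of_pos (by norm_num : (0:ℝ) < 3)]
    exact abs_smallRoot_le hc1 (hfb x)
  -- `16/3` is the reciprocal of the lower bound `3/16` for the discriminant.
  have hwb : ∀ x, (opLDeriv v x / Real.sqrt (c ^ 2 - 2 * opL v x)) ^ 2 ≤
      16 / 3 * opLDeriv v x ^ 2 := by
    intro x
    obtain ⟨h1, h2, h3⟩ := sqrt_bounds hc1 (hfb x)
    rw [div_pow, h2, div_le_iff₀ (by linarith)]
    nlinarith [sq_nonneg (opLDeriv v x)]
  have hw2 : Integrable fun x => (opLDeriv v x / Real.sqrt (c ^ 2 - 2 * opL v x)) ^ 2 := by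
    refine (hv.memLp_opLDeriv.integrable_sq.const_mul (16 / 3)).mono'
      (hwc.pow 2).aestronglyMeasurable (Eventually.of_forall fun x => ?_)
    rw [Real.norm_of_nonneg (sq_nonneg _)]
    exact hwb x
  have hpair : H1Pair (fun x => smallRoot c (opL v x))
      (fun x => opLDeriv v x / Real.sqrt (c ^ 2 - 2 * opL v x)) := by
    refine ⟨hu2, (memLp_two_iff_integrable_sq hwc.aestronglyMeasurable).2 hw2, fun a b => ?_⟩
    exact (intervalIntegral.integral_eq_sub_of_hasDerivAt (fun x _ => hder x)
      (hwc.intervalIntegrable a b)).symm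
  refine ⟨_, _, hpair, hcQ, ?_, ?_⟩
  · refine J_le_of_linearized hpair.bddL2 hv hcQ (fun x => smallRoot_spec hc1 (hfb x)) fun x => ?_
    have h1 := (abs_le.1 (abs_smallRoot_le hc1 (hfb x))).2
    have h2 := (abs_le.1 (hM x)).2
    have h3 := hfb x
    linarith
  -- The constant obtained is `16/3 · M/3 = 16 M/9 ≤ 2 M`.
  · have h := integral_mono hw2 (hv.memLp_opLDeriv.integrable_sq.const_mul (16 / 3)) hwb
    rw [integral_const_mul] at h
    nlinarith

/-! ### The constrained problem -/

theorem J_congr {u v : ℝ → ℝ} (h : u =ᵐ[volume] v) : J u = J v := by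
  unfold J
  rw [opL_congr h, integral_congr_ae (h.mono fun x hx => by simp only [hx] :
    (fun x => u x * opL v x) =ᵐ[volume] fun x => v x * opL v x),
    integral_congr_ae (h.mono fun x hx => by simp only [hx] :
    (fun x => u x ^ 3) =ᵐ[volume] fun x => v x ^ 3)]

theorem Q_congr {u v : ℝ → ℝ} (h : u =ᵐ[volume] v) : Q u = Q v :=
  integral_congr_ae (h.mono fun x hx => by simp only [hx])

theorem Q_nonneg (u : ℝ → ℝ) : 0 ≤ Q u := integral_nonneg fun _ => sq_nonneg _

theorem MemH1.exists_h1Pair {u : ℝ → ℝ} (hu : MemH1 u) :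
    ∃ v, u =ᵐ[volume] v ∧ H1Pair v (weakDeriv u) :=
  FornbergWhitham.exists_h1Pair hu.1 hu.weakDeriv_spec.1 hu.weakDeriv_spec.2

theorem H1Pair.mem_V {u w : ℝ → ℝ} (h : H1Pair u w) {q r : ℝ} (hr : 0 < r) (hq : Q u = q)
    (hlt : q + ∫ x, w x ^ 2 < r ^ 2) : u ∈ V q r := by
  refine ⟨h.memH1, hq, ?_⟩
  rw [h1Norm, integral_weakDeriv_sq h.memLp_deriv h.hasWeakDeriv, Real.sqrt_lt' hr]
  change Q u + _ < _
  rwa [hq]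

theorem exists_h1Pair_of_mem_V {u : ℝ → ℝ} {q r : ℝ} (hr : 0 < r) (hu : u ∈ V q r) :
    ∃ v w, u =ᵐ[volume] v ∧ H1Pair v w ∧ Q v = q ∧ q + ∫ x, w x ^ 2 < r ^ 2 ∧
      ∀ x, |v x| ≤ 2 * r := by
  obtain ⟨hu1, hq, hn⟩ := hu
  obtain ⟨v, huv, hv⟩ := hu1.exists_h1Pair
  rw [h1Norm, Real.sqrt_lt' hr] at hn
  change Q u + _ < _ at hn
  rw [hq] at hn
  have hqv : Q v = q := (Q_congr huv).symm.trans hq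
  refine ⟨v, _, huv, hv, hqv, hn, fun x => (hv.abs_le_sqrt_add x).trans ?_⟩
  have : Real.sqrt (Q v + ∫ x, weakDeriv u x ^ 2) ≤ r := by
    rw [Real.sqrt_le_left hr.le, hqv]
    exact hn.le
  exact mul_le_mul_of_nonneg_left this (by norm_num)

theorem J_const_mul (u : ℝ → ℝ) (a : ℝ) : J (fun x => a * u x) =
    -(1 / 2) * (a ^ 2 * ∫ x, u x * opL u x) - (1 / 6) * (a ^ 3 * ∫ x, u x ^ 3) := by
  have e1 : ∀ x, a * u x * opL (fun x => a * u x) x = a ^ 2 * (u x * opL u x) := fun x => by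
    rw [opL_const_mul]; ring
  have e2 : ∀ x, (a * u x) ^ 3 = a ^ 3 * u x ^ 3 := fun x => by ring
  unfold J
  simp_rw [e1, e2, integral_const_mul]

theorem Q_const_mul (u : ℝ → ℝ) (a : ℝ) : Q (fun x => a * u x) = a ^ 2 * Q u := by
  unfold Q
  rw [← integral_const_mul]
  congr 1; ext x; ring

theorem H1Pair.const_mul {u w : ℝ → ℝ} (h : H1Pair u w) (a : ℝ) :
    H1Pair (fun x => a * u x) fun x => a * w x := by
  refine ⟨h.memLp.const_mul a, h.memLp_deriv.const_mul a, fun s t => ?_⟩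
  rw [intervalIntegral.integral_const_mul, ← h.sub_eq]; ring

theorem BddL2.neg_mul_Q_le_J {u : ℝ → ℝ} (hu : BddL2 u) {M : ℝ} (hM : ∀ x, |u x| ≤ M) :
    -((1 / 2 + M / 6) * Q u) ≤ J u := by
  have h1 := hu.integral_mul_opL_le
  have h2 := (le_abs_self _).trans (hu.abs_integral_cube_le hM)
  unfold J Q
  linarith

theorem J_ge_of_mem_V {u : ℝ → ℝ} {q r : ℝ} (hr : 0 < r) (hu : u ∈ V q r) :
    -((1 / 2 + 2 * r / 6) * q) ≤ J u := by
  obtain ⟨v, w, huv, hv, hq, -, hb⟩ := exists_h1Pair_of_mem_V hr hu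
  rw [J_congr huv, ← hq]
  exact hv.bddL2.neg_mul_Q_le_J hb

theorem bddBelow_J_image {q r : ℝ} (hr : 0 < r) : BddBelow (J '' V q r) :=
  ⟨_, by rintro _ ⟨u, hu, rfl⟩; exact J_ge_of_mem_V hr hu⟩

/-! ### Long waves -/

/-- On the Fourier side, `1 - 1/(1 + ξ²) ≤ ξ²`. Here the left side equals `∫ w (L u)'`; after
Young's inequality, `½ ∫ (L u)'²` is absorbed into half of the left side. -/
theorem integral_sq_sub_integral_mul_opL_le {u w : ℝ → ℝ} (hu : BddL2 u)
    (hd : ∀ x, HasDerivAt u (w x) x) (hw : MemLp w 2) :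
    (∫ x, u x ^ 2) - ∫ x, u x * opL u x ≤ ∫ x, w x ^ 2 := by
  have h := integral_mul_deriv_eq_deriv_mul_of_integrable (fun x _ => hd x)
    (fun x _ => hasDerivAt_opLDeriv hu.memLp hu.continuous x)
    (integrable_mul_of_memLp_two hu.memLp (hu.memLp_opL.sub hu.memLp))
    (integrable_mul_of_memLp_two hw hu.memLp_opLDeriv)
    (integrable_mul_of_memLp_two hu.memLp hu.memLp_opLDeriv)
  have e : ∀ x, u x * (opL u x - u x) = u x * opL u x - u x ^ 2 := fun x => by ring
  simp_rw [e] at h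
  rw [integral_sub (hu.integrable_mul_opL hu) hu.memLp.integrable_sq] at h
  have h2 : ∫ x, w x * opLDeriv u x ≤ ∫ x, (1 / 2) * (w x ^ 2 + opLDeriv u x ^ 2) := by
    refine integral_mono (integrable_mul_of_memLp_two hw hu.memLp_opLDeriv)
      ((hw.integrable_sq.add hu.memLp_opLDeriv.integrable_sq).const_mul _) fun x => ?_
    simp only
    nlinarith [sq_nonneg (w x - opLDeriv u x)]
  rw [integral_const_mul, integral_add hw.integrable_sq hu.memLp_opLDeriv.integrable_sq] at h2
  have h3 := hu.integral_mul_opL_self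
  have h4 := hu.integral_sq
  have h5 : 0 ≤ ∫ x, (opL u x - u x) ^ 2 := integral_nonneg fun x => sq_nonneg _
  linarith

theorem hasDerivAt_gaussian (b x : ℝ) :
    HasDerivAt (fun x => Real.exp (-b * x ^ 2)) (-(2 * b * x) * Real.exp (-b * x ^ 2)) x := by
  have := ((hasDerivAt_pow 2 x).const_mul (-b)).exp
  convert! this using 1
  simp; ring

theorem h1Pair_gaussian {b : ℝ} (hb : 0 < b) :
    H1Pair (fun x => Real.exp (-b * x ^ 2)) (fun x => -(2 * b * x) * Real.exp (-b * x ^ 2)) ∧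
      ∫ x, (-(2 * b * x) * Real.exp (-b * x ^ 2)) ^ 2 ≤ 4 * b * Real.sqrt (Real.pi / b) := by
  have hwc : Continuous fun x => -(2 * b * x) * Real.exp (-b * x ^ 2) := by fun_prop
  have hle : ∀ x, (-(2 * b * x) * Real.exp (-b * x ^ 2)) ^ 2 ≤ 4 * b * Real.exp (-b * x ^ 2) := by
    intro x
    -- `t ≤ eᵗ` lets one of the two Gaussian factors absorb `b x²`.
    have h1 : b * x ^ 2 ≤ Real.exp (b * x ^ 2) := (by linarith [Real.add_one_le_exp (b * x ^ 2)])
    have h2 : Real.exp (-b * x ^ 2) * Real.exp (b * x ^ 2) = 1 := by rw [← Real.exp_add]; simp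
    set E := Real.exp (-b * x ^ 2)
    have hE : 0 < E := Real.exp_pos _
    have h3 : E * (b * x ^ 2) ≤ 1 := h2 ▸ mul_le_mul_of_nonneg_left h1 hE.le
    nlinarith [mul_le_mul_of_nonneg_left h3 (by positivity : 0 ≤ 4 * b * E)]
  have hi := (integrable_exp_neg_mul_sq hb).const_mul (4 * b)
  have hi2 : Integrable fun x => (-(2 * b * x) * Real.exp (-b * x ^ 2)) ^ 2 :=
    hi.mono' (hwc.pow 2).aestronglyMeasurable (Eventually.of_forall fun x => by
      rw [Real.norm_of_nonneg (sq_nonneg _)]; exact hle x)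
  refine ⟨⟨?_, (memLp_two_iff_integrable_sq hwc.aestronglyMeasurable).2 hi2, fun s t => ?_⟩, ?_⟩
  · rw [memLp_two_iff_integrable_sq (by fun_prop)]
    refine (integrable_exp_neg_mul_sq (b := 2 * b) (by positivity)).congr
      (Eventually.of_forall fun x => ?_)
    simp only [sq (Real.exp _), ← Real.exp_add]; congr 1; ring
  · exact (intervalIntegral.integral_eq_sub_of_hasDerivAt (fun x _ => hasDerivAt_gaussian b x)
      (hwc.intervalIntegrable _ _)).symm
  · refine (integral_mono hi2 hi hle).trans_eq ?_
    rw [integral_const_mul, integral_gaussian]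

theorem exists_mem_V_J_lt {q r : ℝ} (hq : 0 < q) (hr : 0 < r) (hqr : q < r ^ 2) :
    ∃ u ∈ V q r, J u < -(q / 2) := by
  set s := Real.sqrt Real.pi with hs
  have hs0 : 0 < s := Real.sqrt_pos.2 Real.pi_pos
  have hpi : s ^ 2 = Real.pi := Real.sq_sqrt Real.pi_pos.le
  set k := Real.sqrt 2 with hk
  have hk0 : 0 < k := by positivity
  have hk2 : k ^ 2 = 2 := Real.sq_sqrt (by norm_num)
  set m := Real.sqrt 3 with hm
  have hm0 : 0 < m := by positivity
  -- For the Gaussian of amplitude `A`, `A² = q β k / s`, the bounds below give `J ≤ -q/2 + 2 k q β²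
  -- - A q k / (6 m)`. The last condition on `β` is `(12 m β²)² < A²`, which makes the correction
  -- negative; the second keeps the function in `V q r`.
  obtain ⟨β, hβ0, hβ1, hβ2⟩ : ∃ β : ℝ, 0 < β ∧ q + 4 * k * q * β ^ 2 < r ^ 2 ∧
      144 * m ^ 2 * s * β ^ 3 < q * k := by
    have h1 : Tendsto (fun β : ℝ => q + 4 * k * q * β ^ 2) (𝓝[>] 0) (𝓝 q) := by
      refine Tendsto.mono_left ?_ nhdsWithin_le_nhds
      have : Continuous fun β : ℝ => q + 4 * k * q * β ^ 2 := by fun_prop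
      simpa using this.tendsto 0
    have h2 : Tendsto (fun β : ℝ => 144 * m ^ 2 * s * β ^ 3) (𝓝[>] 0) (𝓝 0) := by
      refine Tendsto.mono_left ?_ nhdsWithin_le_nhds
      have : Continuous fun β : ℝ => 144 * m ^ 2 * s * β ^ 3 := by fun_prop
      simpa using this.tendsto 0
    obtain ⟨β, ⟨ha, hb⟩, hc⟩ := ((h1.eventually_lt_const hqr).and
      (h2.eventually_lt_const (by positivity : 0 < q * k))).and self_mem_nhdsWithin |>.exists
    exact ⟨β, hc, ha, hb⟩
  obtain ⟨hp, hpd⟩ := h1Pair_gaussian (sq_pos_of_pos hβ0)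
  set g := fun x : ℝ => Real.exp (-β ^ 2 * x ^ 2) with hg
  set w := fun x : ℝ => -(2 * β ^ 2 * x) * Real.exp (-β ^ 2 * x ^ 2) with hw
  set A := Real.sqrt (q * β * k / s) with hA
  have hA0 : 0 < A := by positivity
  have hA2 : A ^ 2 = q * β * k / s := Real.sq_sqrt (by positivity)
  have hg2 : Q g = s / (β * k) := by
    have : ∫ x, g x ^ 2 = ∫ x, Real.exp (-(2 * β ^ 2) * x ^ 2) := by
      congr 1; ext x
      simp only [hg, sq (Real.exp _), ← Real.exp_add]; congr 1; ring
    rw [Q, this, integral_gaussian, Real.sqrt_div Real.pi_pos.le, Real.sqrt_mul (by norm_num),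
      Real.sqrt_sq hβ0.le, mul_comm k]
  have hg3 : ∫ x, g x ^ 3 = s / (β * m) := by
    have : ∫ x, g x ^ 3 = ∫ x, Real.exp (-(3 * β ^ 2) * x ^ 2) := by
      congr 1; ext x
      simp only [hg, ← Real.exp_nat_mul]; congr 1; push_cast; ring
    rw [this, integral_gaussian, Real.sqrt_div Real.pi_pos.le, Real.sqrt_mul (by norm_num),
      Real.sqrt_sq hβ0.le, mul_comm m]
  have hw2 : ∫ x, w x ^ 2 ≤ 4 * β * s := by
    refine hpd.trans_eq ?_
    rw [Real.sqrt_div Real.pi_pos.le, Real.sqrt_sq hβ0.le, ← hs]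
    field_simp
  have hpA := hp.const_mul A
  have hQ : Q (fun x => A * g x) = q := by
    rw [Q_const_mul, hA2, hg2]; field_simp
  have hwA : ∫ x, (A * w x) ^ 2 = A ^ 2 * ∫ x, w x ^ 2 := Q_const_mul w A
  have hwA2 : ∫ x, (A * w x) ^ 2 ≤ 4 * k * q * β ^ 2 := by
    rw [hwA]
    refine (mul_le_mul_of_nonneg_left hw2 (sq_nonneg A)).trans_eq ?_
    rw [hA2]; field_simp
  refine ⟨_, hpA.mem_V hr hQ (by linarith), ?_⟩
  have hlong := integral_sq_sub_integral_mul_opL_le hpA.bddL2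
    (fun x => (hasDerivAt_gaussian (β ^ 2) x).const_mul A) hpA.memLp_deriv
  have hcube : ∫ x, (A * g x) ^ 3 = A * q * (k / m) := by
    have : ∫ x, (A * g x) ^ 3 = A ^ 3 * ∫ x, g x ^ 3 := by
      rw [← integral_const_mul]; congr 1; ext x; ring
    rw [this, hg3, pow_succ, hA2]; field_simp
  have hfin : 12 * m * β ^ 2 < A := by
    refine lt_of_pow_lt_pow_left₀ 2 hA0.le ?_
    rw [hA2, lt_div_iff₀ hs0]
    nlinarith
  have hfin2 : 2 * k * q * β ^ 2 < 1 / 6 * (A * q * (k / m)) := by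
    rw [mul_div_assoc', mul_div_assoc', lt_div_iff₀ hm0]
    nlinarith [mul_lt_mul_of_pos_left hfin (by positivity : 0 < q * k)]
  change Q (fun x => A * g x) - _ ≤ ∫ x, (A * w x) ^ 2 at hlong
  rw [hQ] at hlong
  unfold J
  rw [hcube]
  change _ * (∫ x, A * g x * opL (fun x => A * g x) x) - _ < _
  change q - (∫ x, A * g x * opL (fun x => A * g x) x) ≤ _ at hlong
  linarith

/-! ### Subhomogeneity -/

/-- For the smoothed `u`, `J (a u) = a² J u - a² (a - 1)/6 · ∫ u³`, and `J u ≤ -Q u / 2` forces `∫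
u³ ≥ 0`, so scaling up by `a ≥ 1` helps. Smoothing first bounds the scaled derivative term by `8 r
q`. -/
theorem exists_mem_V_J_le {q r : ℝ} (hr : 0 < r) (hr1 : 4 * r ≤ 1 / 32)
    (hqr : q + 8 * r * q < r ^ 2) {v : ℝ → ℝ} (hv : BddL2 v) (hb : ∀ x, |v x| ≤ 4 * r)
    (hQ0 : 0 < Q v) (hQ : Q v ≤ q) (hJ : J v ≤ -(Q v / 2)) :
    ∃ z ∈ V q r, J z ≤ q / Q v * J v := by
  obtain ⟨u, w, hu, hQu, hJu, hw⟩ := exists_smoothing hv hb hr1 hJ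
  set t := q / Q v with ht
  have ht1 : 1 ≤ t := (one_le_div hQ0).2 hQ
  have htq : t * Q v = q := div_mul_cancel₀ _ hQ0.ne'
  set a := Real.sqrt t with ha
  have ha2 : a ^ 2 = t := Real.sq_sqrt (by linarith)
  have ha1 : 1 ≤ a := Real.one_le_sqrt.2 ht1
  have hB := hu.bddL2.integral_mul_opL_le
  change _ ≤ Q u at hB
  have hJz : J (fun x => a * u x) = t * J u - (1 / 6) * (t * (a - 1) * ∫ x, u x ^ 3) := by
    rw [J_const_mul, ← ha2, J]; ring
  refine ⟨fun x => a * u x, (hu.const_mul a).mem_V hr ?_ ?_, ?_⟩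
  · rw [Q_const_mul, hQu, ha2, htq]
  · have : ∫ x, (a * w x) ^ 2 = a ^ 2 * ∫ x, w x ^ 2 := Q_const_mul w a
    rw [this, ha2]
    have := mul_le_mul_of_nonneg_left hw (by linarith : 0 ≤ t)
    have h2 : t * (2 * (4 * r) * Q v) = 8 * r * q := by rw [← htq]; ring
    linarith
  · have hC : 0 ≤ ∫ x, u x ^ 3 := by unfold J at hJu; unfold J at hJ; linarith
    rw [hJz]
    have := mul_nonneg (mul_nonneg (by linarith : 0 ≤ t) (by linarith : 0 ≤ a - 1)) hC
    have := mul_le_mul_of_nonneg_left hJu (by linarith : 0 ≤ t)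
    linarith

/-- If `J v > -Q v / 2`, the bound follows from `I < -q/2`; otherwise `v` yields a competitor in `V
q r`. Only a sup bound is asked of `v`; it is `4 r` because `v` will be a difference of two
functions bounded by `2 r`. -/
theorem div_mul_le_J {q r I : ℝ} (hq : 0 < q) (hr : 0 < r) (hr1 : 4 * r ≤ 1 / 32)
    (hqr : q + 8 * r * q < r ^ 2) (hI : ∀ z ∈ V q r, I ≤ J z) (hI2 : I < -(q / 2))
    {v : ℝ → ℝ} (hv : BddL2 v) (hb : ∀ x, |v x| ≤ 4 * r) (hQ : Q v ≤ q) :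
    Q v / q * I ≤ J v := by
  by_cases hJ : J v ≤ -(Q v / 2)
  -- With `Q v = 0` no rescaling is possible, but then `J v ≥ 0` directly.
  · rcases (Q_nonneg v).eq_or_lt with h0 | h0
    · have := hv.neg_mul_Q_le_J hb
      rw [← h0] at this ⊢
      simpa using this
    · obtain ⟨z, hz, hle⟩ := exists_mem_V_J_le hr hr1 hqr hv hb h0 hQ hJ
      have := mul_le_mul_of_nonneg_left ((hI z hz).trans hle) (by positivity : 0 ≤ Q v / q)
      refine this.trans_eq ?_
      field_simp
  · have := mul_le_mul_of_nonneg_left hI2.le (div_nonneg (Q_nonneg v) hq.le)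
    have h2 : Q v / q * -(q / 2) = -(Q v / 2) := by field_simp
    linarith

/-! ### Weak compactness -/

theorem inner_toLp_toLp {u g : ℝ → ℝ} (hu : MemLp u 2) (hg : MemLp g 2) :
    inner ℝ (hu.toLp u) (hg.toLp g) = ∫ x, u x * g x := by
  rw [L2.inner_def]
  refine integral_congr_ae ?_
  filter_upwards [hu.coeFn_toLp, hg.coeFn_toLp] with x h1 h2
  rw [h1, h2]
  simp [mul_comm]

/-- Sequential Banach–Alaoglu in the dual of `L²`, read through the Riesz isomorphism. -/
theorem exists_weak_limit {u : ℕ → ℝ → ℝ} (hu : ∀ n, MemLp (u n) 2) {C : ℝ}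
    (hC : ∀ n, ∫ x, u n x ^ 2 ≤ C) :
    ∃ φ : ℕ → ℕ, StrictMono φ ∧ ∃ z : ℝ → ℝ, MemLp z 2 ∧ ∀ g : ℝ → ℝ, MemLp g 2 →
      Tendsto (fun n => ∫ x, u (φ n) x * g x) atTop (𝓝 (∫ x, z x * g x)) := by
  have hmem : ∀ n, StrongDual.toWeakDual
      (InnerProductSpace.toDual ℝ (Lp ℝ 2 (volume : Measure ℝ)) ((hu n).toLp (u n))) ∈
      WeakDual.toStrongDual ⁻¹' Metric.closedBall 0 (Real.sqrt C) := by
    intro n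
    simp only [Set.mem_preimage, mem_closedBall_zero_iff]
    change ‖InnerProductSpace.toDual ℝ (Lp ℝ 2 (volume : Measure ℝ)) ((hu n).toLp (u n))‖ ≤ _
    rw [LinearIsometryEquiv.norm_map]
    apply Real.le_sqrt_of_sq_le
    rw [← real_inner_self_eq_norm_sq, inner_toLp_toLp]
    simpa only [← sq] using hC n
  have : Fact ((2 : ENNReal) ≠ ⊤) := ⟨by simp⟩
  obtain ⟨l, -, φ, hφ, hl⟩ := WeakDual.isSeqCompact_closedBall ℝ
    (Lp ℝ 2 (volume : Measure ℝ)) 0 (Real.sqrt C) hmem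
  set Z := (InnerProductSpace.toDual ℝ (Lp ℝ 2 (volume : Measure ℝ))).symm
    (WeakDual.toStrongDual l) with hZ
  refine ⟨φ, hφ, Z, Lp.memLp Z, fun g hg => ?_⟩
  have h := ((WeakDual.eval_continuous (hg.toLp g)).tendsto l).comp hl
  have e1 : l (hg.toLp g) = ∫ x, Z x * g x := by
    rw [← inner_toLp_toLp (Lp.memLp Z) hg, Lp.toLp_coeFn, hZ, InnerProductSpace.toDual_symm_apply]
    rfl
  rw [e1] at h
  refine h.congr fun n => ?_
  rw [← inner_toLp_toLp (hu (φ n)) hg]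
  rfl

/-- Testing with indicators of intervals turns weak convergence of derivatives into convergence of
increments, hence pointwise convergence of the functions. -/
theorem tendsto_intervalIntegral_of_weak {w : ℕ → ℝ → ℝ} {w₀ : ℝ → ℝ}
    (h : ∀ g : ℝ → ℝ, MemLp g 2 → Tendsto (fun n => ∫ x, w n x * g x) atTop
      (𝓝 (∫ x, w₀ x * g x))) (a b : ℝ) :
    Tendsto (fun n => ∫ x in a..b, w n x) atTop (𝓝 (∫ x in a..b, w₀ x)) := by
  have e : ∀ v : ℝ → ℝ, ∫ x in a..b, v x = (if a ≤ b then 1 else -1 : ℝ) •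
      ∫ x, v x * (Set.uIoc a b).indicator (fun _ => (1:ℝ)) x := by
    intro v
    rw [intervalIntegral.intervalIntegral_eq_integral_uIoc, ← integral_indicator measurableSet_uIoc]
    congr 1
    refine integral_congr_ae (Eventually.of_forall fun x => ?_)
    by_cases hx : x ∈ Set.uIoc a b <;> simp [hx]
  simp_rw [e]
  exact (h _ (memLp_indicator_const 2 measurableSet_uIoc 1 (Or.inr (by simp)))).const_smul _

theorem exists_h1Pair_limit {v w : ℕ → ℝ → ℝ} (hv : ∀ n, H1Pair (v n) (w n)) {C M : ℝ}
    (hC : ∀ n, ∫ x, v n x ^ 2 ≤ C) (hC' : ∀ n, ∫ x, w n x ^ 2 ≤ C) (hM : ∀ n x, |v n x| ≤ M) :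
    ∃ φ : ℕ → ℕ, StrictMono φ ∧ ∃ z w₀, H1Pair z w₀ ∧
      (∀ x, Tendsto (fun n => v (φ n) x) atTop (𝓝 (z x))) ∧
      ∀ g : ℝ → ℝ, MemLp g 2 →
        Tendsto (fun n => ∫ x, v (φ n) x * g x) atTop (𝓝 (∫ x, z x * g x)) := by
  obtain ⟨φ₁, hφ₁, y, hy, hyl⟩ := exists_weak_limit (fun n => (hv n).memLp) hC
  obtain ⟨φ₂, hφ₂, w₀, hw₀, hwl⟩ := exists_weak_limit (fun n => (hv (φ₁ n)).memLp_deriv)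
    fun n => hC' (φ₁ n)
  obtain ⟨α, -, φ₃, hφ₃, hα⟩ := (isCompact_Icc (a := -M) (b := M)).tendsto_subseq
    (x := fun n => v (φ₁ (φ₂ n)) 0) fun n => abs_le.1 (hM _ 0)
  set φ := fun n => φ₁ (φ₂ (φ₃ n)) with hφ
  have hφm : StrictMono φ := hφ₁.comp (hφ₂.comp hφ₃)
  set z := fun x => α + ∫ t in (0:ℝ)..x, w₀ t with hz
  have hzc : Continuous z :=
    continuous_const.add (continuous_intervalIntegral_of_memLp hw₀ 0)
  have hpt : ∀ x, Tendsto (fun n => v (φ n) x) atTop (𝓝 (z x)) := by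
    intro x
    have h1 : Tendsto (fun n => ∫ t in (0:ℝ)..x, w (φ n) t) atTop (𝓝 (∫ t in (0:ℝ)..x, w₀ t)) :=
      tendsto_intervalIntegral_of_weak (w := fun n => w (φ n))
        (fun g hg => (hwl g hg).comp hφ₃.tendsto_atTop) 0 x
    refine (hα.add h1).congr fun n => ?_
    simp only [Function.comp, ← (hv _).sub_eq, hφ]
    ring
  have hweak : ∀ g : ℝ → ℝ, MemLp g 2 →
      Tendsto (fun n => ∫ x, v (φ n) x * g x) atTop (𝓝 (∫ x, y x * g x)) := fun g hg =>
    (hyl g hg).comp (hφ₂.comp hφ₃).tendsto_atTop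
  -- The pointwise limit `z` and the weak limit `y` give the same integrals against test functions,
  -- by dominated convergence.
  have hzy : z =ᵐ[volume] y := by
    refine ae_eq_of_integral_contDiff_smul_eq hzc.locallyIntegrable
      (MemLp.locallyIntegrable_two hy) fun g hg hgc => ?_
    simp only [smul_eq_mul, mul_comm (g _)]
    refine tendsto_nhds_unique ?_
      (hweak g (memLp_two_of_hasCompactSupport hg.continuous hgc))
    refine tendsto_integral_of_dominated_convergence (fun x => M * |g x|)
      (fun n => ((hv _).continuous.mul hg.continuous).aestronglyMeasurable)
      ((hg.continuous.integrable_of_hasCompactSupport hgc).abs.const_mul M)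
      (fun n => Eventually.of_forall fun x => ?_)
      (Eventually.of_forall fun x => (hpt x).mul_const _)
    rw [norm_mul]
    exact mul_le_mul_of_nonneg_right (hM _ x) (abs_nonneg _)
  refine ⟨φ, hφm, z, w₀, ⟨(memLp_congr_ae hzy).2 hy, hw₀, fun a b => ?_⟩, hpt, fun g hg => ?_⟩
  · simp only [hz]
    rw [← intervalIntegral.integral_add_adjacent_intervals
      (intervalIntegrable_of_memLp_two hw₀ 0 a) (intervalIntegrable_of_memLp_two hw₀ a b)]
    ring
  · rw [integral_congr_ae (hzy.mono fun x hx => by simp only [hx] :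
      (fun x => z x * g x) =ᵐ[volume] fun x => y x * g x)]
    exact hweak g hg

/-! ### Splitting along weakly convergent sequences -/

/-- The difference is written `v n + -1 * z` to match the expansions of `u + ε * v` at `ε = -1`. -/
theorem tendsto_Q_sub_Q_add {v : ℕ → ℝ → ℝ} {z : ℝ → ℝ} (hv : ∀ n, BddL2 (v n)) (hz : BddL2 z)
    (hweak : ∀ g : ℝ → ℝ, MemLp g 2 →
      Tendsto (fun n => ∫ x, v n x * g x) atTop (𝓝 (∫ x, z x * g x))) :
    Tendsto (fun n => Q (v n) - Q (fun x => v n x + -1 * z x)) atTop (𝓝 (Q z)) := by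
  have e : ∀ n, Q (v n) - Q (fun x => v n x + -1 * z x) = 2 * (∫ x, v n x * z x) - Q z := by
    intro n
    have e1 : ∀ x, (v n x + -1 * z x) ^ 2 = v n x ^ 2 - 2 * (v n x * z x) + z x ^ 2 :=
      fun x => by ring
    have i1 := ((hv n).integrable_mul hz).const_mul 2
    have i2 : Integrable fun x => v n x ^ 2 - 2 * (v n x * z x) :=
      (hv n).memLp.integrable_sq.sub i1
    unfold Q
    simp_rw [e1]
    rw [integral_add i2 hz.memLp.integrable_sq, integral_sub (hv n).memLp.integrable_sq i1,
      integral_const_mul]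
    ring
  simp_rw [e]
  have h := ((hweak z hz.memLp).const_mul 2).sub_const (Q z)
  have e2 : 2 * (∫ x, z x * z x) - Q z = Q z := by
    simp_rw [Q, sq]; ring
  rwa [e2] at h

/-- Cauchy–Schwarz against the `L²`-bounded `v n`: the factor `z (v n - z)` tends to `0` in `L²` by
dominated convergence, with a multiple of `z²` as majorant. -/
theorem tendsto_integral_cross {v : ℕ → ℝ → ℝ} {z : ℝ → ℝ} (hv : ∀ n, BddL2 (v n))
    (hz : BddL2 z) {C M : ℝ} (hC : ∀ n, ∫ x, v n x ^ 2 ≤ C) (hM : ∀ n x, |v n x| ≤ M)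
    (hpt : ∀ x, Tendsto (fun n => v n x) atTop (𝓝 (z x))) :
    Tendsto (fun n => ∫ x, v n x * (z x * (v n x + -1 * z x))) atTop (𝓝 0) := by
  have hzM : ∀ x, |z x| ≤ M := fun x => le_of_tendsto ((hpt x).abs) (Eventually.of_forall
    fun n => hM n x)
  have hB : ∀ n, BddL2 fun x => z x * (v n x + -1 * z x) := fun n =>
    hz.mul ((hv n).add_const_mul hz (-1))
  have h0 : Tendsto (fun n => ∫ x, (z x * (v n x + -1 * z x)) ^ 2) atTop (𝓝 0) := by
    have : (0:ℝ) = ∫ x : ℝ, (0:ℝ) := by simp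
    rw [this]
    refine tendsto_integral_of_dominated_convergence (fun x => (2 * M) ^ 2 * z x ^ 2)
      (fun n => ((hB n).continuous.pow 2).aestronglyMeasurable)
      (hz.memLp.integrable_sq.const_mul _) (fun n => Eventually.of_forall fun x => ?_)
      (Eventually.of_forall fun x => ?_)
    · rw [Real.norm_of_nonneg (sq_nonneg _), mul_pow, mul_comm]
      refine mul_le_mul_of_nonneg_right (sq_le_sq' ?_ ?_) (sq_nonneg _)
      · have h1 := abs_le.1 (hM n x)
        have h2 := abs_le.1 (hzM x)
        linarith
      · have h1 := abs_le.1 (hM n x)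
        have h2 := abs_le.1 (hzM x)
        linarith
    · have h1 : Tendsto (fun n => (z x * (v n x + -1 * z x)) ^ 2) atTop
          (𝓝 ((z x * (z x + -1 * z x)) ^ 2)) :=
        (((hpt x).add_const _).const_mul _).pow 2
      simpa using h1
  have hC0 : 0 ≤ C := (integral_nonneg fun x => sq_nonneg _).trans (hC 0)
  have h1 := (h0.const_mul C).sqrt
  simp only [mul_zero, Real.sqrt_zero] at h1
  refine squeeze_zero_norm (fun n => ?_) h1
  rw [Real.norm_eq_abs]
  apply Real.abs_le_sqrt
  refine (sq_integral_mul_le (hv n).memLp (hB n).memLp).trans ?_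
  exact mul_le_mul_of_nonneg_right (hC n) (integral_nonneg fun x => sq_nonneg _)

/-- The quadratic cross term is `∫ v n · L z`, a weak pairing; the cubic one comes from `(v - z)³ =
v³ - z³ - 3 v z (v - z)`. -/
theorem tendsto_J_sub_J_add {v : ℕ → ℝ → ℝ} {z : ℝ → ℝ} (hv : ∀ n, BddL2 (v n)) (hz : BddL2 z)
    {C M : ℝ} (hC : ∀ n, ∫ x, v n x ^ 2 ≤ C) (hM : ∀ n x, |v n x| ≤ M)
    (hpt : ∀ x, Tendsto (fun n => v n x) atTop (𝓝 (z x)))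
    (hweak : ∀ g : ℝ → ℝ, MemLp g 2 →
      Tendsto (fun n => ∫ x, v n x * g x) atTop (𝓝 (∫ x, z x * g x))) :
    Tendsto (fun n => J (v n) - J (fun x => v n x + -1 * z x)) atTop (𝓝 (J z)) := by
  have e : ∀ n, J (v n) - J (fun x => v n x + -1 * z x) =
      (-(∫ x, v n x * opL z x) + (1 / 2) * ∫ x, z x * opL z x) - (1 / 6) * (∫ x, z x ^ 3)
        - (1 / 2) * ∫ x, v n x * (z x * (v n x + -1 * z x)) := by
    intro n
    have e1 : ∀ x, (v n x + -1 * z x) ^ 3 = v n x ^ 3 - z x ^ 3 -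
        3 * (v n x * (z x * (v n x + -1 * z x))) := fun x => by ring
    have i1 : Integrable fun x => 3 * (v n x * (z x * (v n x + -1 * z x))) :=
      ((hv n).integrable_mul (hz.mul ((hv n).add_const_mul hz (-1)))).const_mul 3
    have i2 : Integrable fun x => v n x ^ 3 - z x ^ 3 :=
      (hv n).integrable_cube.sub hz.integrable_cube
    have e2 : ∫ x, (v n x + -1 * z x) ^ 3 = (∫ x, v n x ^ 3) - (∫ x, z x ^ 3) -
        3 * ∫ x, v n x * (z x * (v n x + -1 * z x)) := by
      simp_rw [e1]
      rw [integral_sub i2 i1, integral_sub (hv n).integrable_cube hz.integrable_cube,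
        integral_const_mul]
    unfold J
    rw [(hv n).integral_add_mul_opL_add hz, hz.integral_mul_opL_comm (hv n), e2]
    ring
  simp_rw [e]
  have h := (((hweak _ hz.memLp_opL).neg.add_const ((1 / 2) * ∫ x, z x * opL z x)).sub_const
    ((1 / 6) * ∫ x, z x ^ 3)).sub ((tendsto_integral_cross hv hz hC hM hpt).const_mul (1 / 2))
  convert! h using 2
  unfold J; ring

/-! ### Existence of minimizers -/

theorem J_comp_add_right (u : ℝ → ℝ) (a : ℝ) : J (fun x => u (x + a)) = J u := by
  unfold J
  simp_rw [opL_comp_add_right]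
  rw [integral_add_right_eq_self (fun x => u x * opL u x) a,
    integral_add_right_eq_self (fun x => u x ^ 3) a]

theorem Q_comp_add_right (u : ℝ → ℝ) (a : ℝ) : Q (fun x => u (x + a)) = Q u :=
  integral_add_right_eq_self (fun x => u x ^ 2) a

theorem H1Pair.comp_add_right {u w : ℝ → ℝ} (h : H1Pair u w) (a : ℝ) :
    H1Pair (fun x => u (x + a)) fun x => w (x + a) := by
  refine ⟨memLp_comp_add_right h.memLp a, memLp_comp_add_right h.memLp_deriv a, fun s t => ?_⟩
  rw [intervalIntegral.integral_comp_add_right w a, h.sub_eq]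

theorem Q_pos_of_continuous {z : ℝ → ℝ} (hz : BddL2 z) {x : ℝ} (hx : z x ≠ 0) : 0 < Q z := by
  rw [Q, integral_pos_iff_support_of_nonneg (fun x => sq_nonneg _) hz.memLp.integrable_sq]
  refine IsOpen.measure_pos _ ((hz.continuous.pow 2).isOpen_support) ⟨x, ?_⟩
  exact pow_ne_zero 2 hx

/-- Below the level `-Q / 2`, a function cannot be uniformly small. -/
theorem BddL2.exists_lt_abs {v : ℝ → ℝ} (hv : BddL2 v) {δ : ℝ} (hδ : 0 < δ) (hQ : 0 < Q v)
    (hJ : J v < -(Q v / 2) - δ) : ∃ x, 3 * δ / Q v < |v x| := by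
  by_contra! h
  have h1 := (le_abs_self _).trans (hv.abs_integral_cube_le h)
  have h2 := hv.integral_mul_opL_le
  change _ ≤ 3 * δ / Q v * Q v at h1
  rw [div_mul_cancel₀ _ hQ.ne'] at h1
  change _ ≤ Q v at h2
  unfold J at hJ
  linarith

theorem exists_minimizing_seq {q r : ℝ} (hq : 0 < q) (hr : 0 < r)
    (hI : sInf (J '' V q r) < -(q / 2)) (hne : (V q r).Nonempty) :
    ∃ (v w : ℕ → ℝ → ℝ) (η : ℝ), 0 < η ∧ (∀ n, H1Pair (v n) (w n)) ∧ (∀ n, Q (v n) = q) ∧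
      (∀ n, q + ∫ x, w n x ^ 2 < r ^ 2) ∧ (∀ n x, |v n x| ≤ 2 * r) ∧ (∀ n, η ≤ |v n 0|) ∧
      Tendsto (fun n => J (v n)) atTop (𝓝 (sInf (J '' V q r))) := by
  obtain ⟨a, -, ha, haV⟩ := exists_seq_tendsto_sInf (hne.image J) (bddBelow_J_image (q := q) hr)
  choose u huV hua using haV
  choose v₀ w₀ huv hpair hQ hlt hb using fun n => exists_h1Pair_of_mem_V hr (huV n)
  have hJ : ∀ n, J (v₀ n) = a n := fun n => (J_congr (huv n)).symm.trans (hua n)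
  -- Half of the gap: beyond some `N` the values of `J` stay below `-q/2 - δ`, so each function
  -- exceeds `3 δ / q` in modulus somewhere, and that point is translated to the origin.
  set δ := (-(q / 2) - sInf (J '' V q r)) / 2 with hδ
  have hδ0 : 0 < δ := by linarith
  obtain ⟨N, hN⟩ := eventually_atTop.1
    (ha.eventually_lt_const (by linarith : sInf (J '' V q r) < -(q / 2) - δ))
  have hx : ∀ n, ∃ x, 3 * δ / q < |v₀ (n + N) x| := by
    intro n
    have h := (hpair (n + N)).bddL2.exists_lt_abs hδ0 (by rw [hQ]; exact hq)
      (by rw [hJ, hQ]; exact hN _ (Nat.le_add_left _ _))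
    rwa [hQ] at h
  choose x hx using hx
  refine ⟨fun n y => v₀ (n + N) (y + x n), fun n y => w₀ (n + N) (y + x n), 3 * δ / q,
    by positivity, fun n => (hpair _).comp_add_right _, fun n => ?_, fun n => ?_,
    fun n y => hb _ _, fun n => ?_, ?_⟩
  · rw [Q_comp_add_right, hQ]
  · rw [integral_add_right_eq_self (fun y => w₀ (n + N) y ^ 2) (x n)]
    exact hlt _
  · simpa using (hx n).le
  · simp_rw [J_comp_add_right, hJ]
    exact ha.comp (tendsto_add_atTop_nat N)

theorem G_nonempty {q r : ℝ} (hq : 0 < q) (hr : 0 < r) (hr1 : 4 * r ≤ 1 / 32)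
    (hqr : q + 8 * r * q < r ^ 2) : (G q r).Nonempty := by
  have hqr' : q < r ^ 2 := by nlinarith [mul_pos hr hq]
  obtain ⟨u₀, hu₀, hJ₀⟩ := exists_mem_V_J_lt hq hr hqr'
  set I := sInf (J '' V q r) with hI
  have hIle : ∀ z ∈ V q r, I ≤ J z := fun z hz =>
    csInf_le (bddBelow_J_image hr) (Set.mem_image_of_mem J hz)
  have hI2 : I < -(q / 2) := (hIle u₀ hu₀).trans_lt hJ₀
  obtain ⟨v, w, η, hη, hpair, hQ, hlt, hb, h0, hJ⟩ := exists_minimizing_seq hq hr hI2 ⟨u₀, hu₀⟩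
  have hv2 : ∀ n, ∫ x, v n x ^ 2 ≤ r ^ 2 := fun n => (hQ n).trans_le hqr'.le
  have hw2 : ∀ n, ∫ x, w n x ^ 2 ≤ r ^ 2 := fun n => by linarith [hlt n]
  obtain ⟨φ, hφ, z, w₀, hz, hpt, hweak⟩ := exists_h1Pair_limit hpair hv2 hw2 hb
  have hzb : ∀ x, |z x| ≤ 2 * r := fun x =>
    le_of_tendsto (hpt x).abs (Eventually.of_forall fun n => hb _ x)
  have hz0 : z 0 ≠ 0 := by
    have : η ≤ |z 0| := ge_of_tendsto (hpt 0).abs (Eventually.of_forall fun n => h0 _)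
    exact abs_pos.1 (hη.trans_le this)
  have hθ : 0 < Q z := Q_pos_of_continuous hz.bddL2 hz0
  have hB : ∀ n, BddL2 (v (φ n)) := fun n => (hpair _).bddL2
  have hD : ∀ n, BddL2 fun x => v (φ n) x + -1 * z x := fun n =>
    (hB n).add_const_mul hz.bddL2 (-1)
  have hDb : ∀ n x, |v (φ n) x + -1 * z x| ≤ 4 * r := fun n x => by
    have h1 := abs_le.1 (hb (φ n) x)
    have h2 := abs_le.1 (hzb x)
    exact abs_le.2 ⟨by linarith, by linarith⟩
  have hQlim : Tendsto (fun n => Q (fun x => v (φ n) x + -1 * z x)) atTop (𝓝 (q - Q z)) := by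
    refine ((tendsto_Q_sub_Q_add hB hz.bddL2 hweak).const_sub q).congr fun n => ?_
    rw [hQ]; ring
  have hJlim : Tendsto (fun n => J (fun x => v (φ n) x + -1 * z x)) atTop (𝓝 (I - J z)) := by
    refine ((hJ.comp hφ.tendsto_atTop).sub (tendsto_J_sub_J_add hB hz.bddL2
      (fun n => hv2 (φ n)) (fun n => hb (φ n)) hpt hweak)).congr fun n => ?_
    simp only [Function.comp]; ring
  have hle : Q z ≤ q := by
    have := ge_of_tendsto hQlim (Eventually.of_forall fun n => Q_nonneg _)
    linarith
  -- The linear lower bound for the remainders, in the limit. Their `Q` is eventually at most `q`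
  -- because `Q z > 0`.
  have hJz : (q - Q z) / q * I ≤ I - J z := by
    refine le_of_tendsto_of_tendsto ((hQlim.div_const q).mul_const I) hJlim ?_
    filter_upwards [hQlim.eventually_le_const (by linarith : q - Q z < q)] with n hn
    exact div_mul_le_J hq hr hr1 hqr hIle hI2 (hD n) (hDb n) hn
  have hJz' : J z ≤ Q z / q * I := by
    have : (q - Q z) / q * I = I - Q z / q * I := by field_simp
    linarith
  have hneg : J z ≤ -(Q z / 2) := by
    refine hJz'.trans ((mul_le_mul_of_nonneg_left hI2.le (by positivity)).trans_eq ?_)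
    field_simp
  -- The minimizer is the smoothed and rescaled weak limit, since `z` need not have `Q z = q`.
  obtain ⟨y, hy, hyJ⟩ := exists_mem_V_J_le hr hr1 hqr hz.bddL2
    (fun x => (hzb x).trans (by linarith)) hθ hle hneg
  refine ⟨y, hy, isMinOn_iff.2 fun x hx => ?_⟩
  have h1 : q / Q z * J z ≤ q / Q z * (Q z / q * I) :=
    mul_le_mul_of_nonneg_left hJz' (by positivity)
  have h2 : q / Q z * (Q z / q * I) = I := by field_simp
  linarith [hIle x hx]

theorem exists_forall_G_nonempty {κ : ℝ} (hκ0 : 0 < κ) (hκ1 : κ < 1) :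
    ∃ r₀ : ℝ, 0 < r₀ ∧ ∀ r : ℝ, 0 < r → r < r₀ →
      ∀ q : ℝ, 0 < q → q ≤ κ * r ^ 2 → (G q r).Nonempty := by
  -- `r < 1/128` gives `4 r ≤ 1/32`; `8 r < 1 - κ` gives `κ (1 + 8 r) < κ (2 - κ) < 1`, hence `q + 8
  -- r q < r²`.
  refine ⟨min (1 / 128) ((1 - κ) / 8), lt_min (by norm_num) (by linarith), fun r hr hlt q hq hqr =>
    G_nonempty hq hr ?_ ?_⟩
  · have := hlt.trans_le (min_le_left _ _)
    linarith
  · have h := hlt.trans_le (min_le_right _ _)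
    have h1 : q * (1 + 8 * r) ≤ κ * r ^ 2 * (1 + 8 * r) :=
      mul_le_mul_of_nonneg_right hqr (by linarith)
    have h2 : κ * (1 + 8 * r) < 1 := by nlinarith
    nlinarith [mul_lt_mul_of_pos_right h2 (pow_pos hr 2)]

/-! ### The Lagrange multiplier -/

theorem BddL2.Q_add_const_mul {u v : ℝ → ℝ} (hu : BddL2 u) (hv : BddL2 v) (ε : ℝ) :
    Q (fun x => u x + ε * v x) = Q u + 2 * ε * (∫ x, u x * v x) + ε ^ 2 * Q v := by
  have e : ∀ x, (u x + ε * v x) ^ 2 = u x ^ 2 + (2 * ε * (u x * v x) + ε ^ 2 * v x ^ 2) :=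
    fun x => by ring
  have i1 := (hu.integrable_mul hv).const_mul (2 * ε)
  have i2 := hv.memLp.integrable_sq.const_mul (ε ^ 2)
  have i12 : Integrable fun x => 2 * ε * (u x * v x) + ε ^ 2 * v x ^ 2 := i1.add i2
  unfold Q
  simp_rw [e]
  rw [integral_add hu.memLp.integrable_sq i12, integral_add i1 i2, integral_const_mul,
    integral_const_mul]
  ring

theorem BddL2.integral_cube_add_const_mul {u v : ℝ → ℝ} (hu : BddL2 u) (hv : BddL2 v) (ε : ℝ) :
    ∫ x, (u x + ε * v x) ^ 3 = (∫ x, u x ^ 3) + 3 * ε * (∫ x, u x ^ 2 * v x) +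
      3 * ε ^ 2 * (∫ x, u x * v x ^ 2) + ε ^ 3 * ∫ x, v x ^ 3 := by
  have e : ∀ x, (u x + ε * v x) ^ 3 = u x ^ 3 + (3 * ε * (u x ^ 2 * v x) +
      (3 * ε ^ 2 * (u x * v x ^ 2) + ε ^ 3 * v x ^ 3)) := fun x => by ring
  have i1 : Integrable fun x => 3 * ε * (u x ^ 2 * v x) := by
    simpa only [sq] using ((hu.mul hu).integrable_mul hv).const_mul (3 * ε)
  have i2 : Integrable fun x => 3 * ε ^ 2 * (u x * v x ^ 2) := by
    simpa only [sq (v _)] using (hu.integrable_mul (hv.mul hv)).const_mul (3 * ε ^ 2)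
  have i3 := hv.integrable_cube.const_mul (ε ^ 3)
  have i23 : Integrable fun x => 3 * ε ^ 2 * (u x * v x ^ 2) + ε ^ 3 * v x ^ 3 := i2.add i3
  have i123 : Integrable fun x => 3 * ε * (u x ^ 2 * v x) +
      (3 * ε ^ 2 * (u x * v x ^ 2) + ε ^ 3 * v x ^ 3) := i1.add i23
  simp_rw [e]
  rw [integral_add hu.integrable_cube i123, integral_add i1 i23, integral_add i2 i3,
    integral_const_mul, integral_const_mul, integral_const_mul]
  ring

/-- Along a line `u + ε v` the functionals `Q`, `∫ u L u` and `∫ u³` are polynomials in `ε` of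
degree at most three, so their derivatives at `0` are linear coefficients. -/
theorem hasDerivAt_cubic_zero (a b c d : ℝ) :
    HasDerivAt (fun ε : ℝ => a + b * ε + c * ε ^ 2 + d * ε ^ 3) b 0 := by
  have := (((hasDerivAt_id (0:ℝ)).const_mul b).const_add a).add
    (((hasDerivAt_pow 2 (0:ℝ)).const_mul c)) |>.add ((hasDerivAt_pow 3 (0:ℝ)).const_mul d)
  convert! this using 1
  simp

theorem BddL2.hasDerivAt_Q {u v : ℝ → ℝ} (hu : BddL2 u) (hv : BddL2 v) :
    HasDerivAt (fun ε : ℝ => Q (fun x => u x + ε * v x)) (2 * ∫ x, u x * v x) 0 := by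
  convert! hasDerivAt_cubic_zero (Q u) (2 * ∫ x, u x * v x) (Q v) 0 using 1
  ext ε
  rw [hu.Q_add_const_mul hv]; ring

theorem BddL2.hasDerivAt_integral_mul_opL {u v : ℝ → ℝ} (hu : BddL2 u) (hv : BddL2 v) :
    HasDerivAt (fun ε : ℝ => ∫ x, (u x + ε * v x) * opL (fun y => u y + ε * v y) x)
      (2 * ∫ x, v x * opL u x) 0 := by
  convert! hasDerivAt_cubic_zero (∫ x, u x * opL u x) (2 * ∫ x, v x * opL u x)
    (∫ x, v x * opL v x) 0 using 1
  ext ε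
  rw [hu.integral_add_mul_opL_add hv]; ring

theorem BddL2.hasDerivAt_integral_cube {u v : ℝ → ℝ} (hu : BddL2 u) (hv : BddL2 v) :
    HasDerivAt (fun ε : ℝ => ∫ x, (u x + ε * v x) ^ 3) (3 * ∫ x, u x ^ 2 * v x) 0 := by
  convert! hasDerivAt_cubic_zero (∫ x, u x ^ 3) (3 * ∫ x, u x ^ 2 * v x)
    (3 * ∫ x, u x * v x ^ 2) (∫ x, v x ^ 3) using 1
  ext ε
  rw [hu.integral_cube_add_const_mul hv]; ring

theorem BddL2.hasDerivAt_J {u v : ℝ → ℝ} (hu : BddL2 u) (hv : BddL2 v) :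
    HasDerivAt (fun ε : ℝ => J (fun x => u x + ε * v x))
      (-(∫ x, v x * opL u x) - (1 / 2) * ∫ x, u x ^ 2 * v x) 0 := by
  have h := ((hu.hasDerivAt_integral_mul_opL hv).const_mul (-(1 / 2))).sub
    ((hu.hasDerivAt_integral_cube hv).const_mul (1 / 6))
  convert! h using 1
  ring

theorem H1Pair.add_const_mul {u w v z : ℝ → ℝ} (hu : H1Pair u w) (hv : H1Pair v z) (ε : ℝ) :
    H1Pair (fun x => u x + ε * v x) fun x => w x + ε * z x := by
  refine ⟨hu.memLp.add (hv.memLp.const_mul ε), hu.memLp_deriv.add (hv.memLp_deriv.const_mul ε),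
    fun s t => ?_⟩
  rw [intervalIntegral.integral_add (intervalIntegrable_of_memLp_two hu.memLp_deriv _ _)
    ((intervalIntegrable_of_memLp_two hv.memLp_deriv _ _).const_mul ε),
    intervalIntegral.integral_const_mul, ← hu.sub_eq, ← hv.sub_eq]
  ring

theorem continuous_integral_add_const_mul_sq {w z : ℝ → ℝ} (hw : MemLp w 2) (hz : MemLp z 2) :
    Continuous fun ε : ℝ => ∫ x, (w x + ε * z x) ^ 2 := by
  have e : ∀ ε : ℝ, ∫ x, (w x + ε * z x) ^ 2 =
      (∫ x, w x ^ 2) + (2 * ε * (∫ x, w x * z x) + ε ^ 2 * ∫ x, z x ^ 2) := by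
    intro ε
    have e1 : ∀ x, (w x + ε * z x) ^ 2 = w x ^ 2 + (2 * ε * (w x * z x) + ε ^ 2 * z x ^ 2) :=
      fun x => by ring
    have i1 := (integrable_mul_of_memLp_two hw hz).const_mul (2 * ε)
    have i2 := hz.integrable_sq.const_mul (ε ^ 2)
    have i12 : Integrable fun x => 2 * ε * (w x * z x) + ε ^ 2 * z x ^ 2 := i1.add i2
    simp_rw [e1]
    rw [integral_add hw.integrable_sq i12, integral_add i1 i2, integral_const_mul,
      integral_const_mul]
  simp_rw [e]
  fun_prop

/-- The Euler–Lagrange equation of a minimizer, tested against an `H¹` function. -/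
theorem H1Pair.euler_lagrange {u w v z : ℝ → ℝ} {q r : ℝ} (hq : 0 < q) (hr : 0 < r)
    (hu : H1Pair u w) (hQ : Q u = q) (hlt : q + ∫ x, w x ^ 2 < r ^ 2)
    (hmin : ∀ y ∈ V q r, J u ≤ J y) (hv : H1Pair v z) :
    (∫ x, v x * opL u x) + (1 / 2) * ∫ x, u x ^ 2 * v x =
      ((∫ x, u x * opL u x) + (1 / 2) * ∫ x, u x ^ 3) / q * ∫ x, u x * v x := by
  have hQd := hu.bddL2.hasDerivAt_Q hv.bddL2
  have hQ0 : Q (fun x => u x + 0 * v x) = q := by simpa using hQ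
  -- This factor returns `u + ε v` to the constraint `Q = q`.
  set a : ℝ → ℝ := fun ε => Real.sqrt (q / Q (fun x => u x + ε * v x)) with ha
  have ha0 : a 0 = 1 := by simp only [ha, hQ0, div_self hq.ne', Real.sqrt_one]
  have had : HasDerivAt a (-(∫ x, u x * v x) / q) 0 := by
    have h := ((hasDerivAt_const (0:ℝ) q).div hQd (by rw [hQ0]; exact hq.ne')).sqrt (by
      simp only [Pi.div_apply, hQ0, div_self hq.ne']; norm_num)
    convert! h using 1
    simp only [Pi.div_apply, hQ0, div_self hq.ne', Real.sqrt_one]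
    field_simp
    ring
  have hB := hu.bddL2.hasDerivAt_integral_mul_opL hv.bddL2
  have hC := hu.bddL2.hasDerivAt_integral_cube hv.bddL2
  have hh := (((had.pow 2).mul hB).const_mul (-(1 / 2))).sub
    (((had.pow 3).mul hC).const_mul (1 / 6))
  -- The norm bound is strict at `ε = 0`, so by continuity the normalized curve stays in `V q r`
  -- nearby.
  have hloc : IsLocalMin (fun ε => J (fun x => a ε * (u x + ε * v x))) 0 := by
    have hpos : ∀ᶠ ε in 𝓝 (0:ℝ), 0 < Q (fun x => u x + ε * v x) :=
      hQd.continuousAt.eventually_const_lt (by simpa only [hQ0] using hq)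
    have hcont : ContinuousAt (fun ε => q + a ε ^ 2 * ∫ x, (w x + ε * z x) ^ 2) 0 :=
      continuousAt_const.add ((had.continuousAt.pow 2).mul
        (continuous_integral_add_const_mul_sq hu.memLp_deriv hv.memLp_deriv).continuousAt)
    have hsmall := hcont.eventually_lt_const (u := r ^ 2) (by simpa [ha0] using hlt)
    filter_upwards [hpos, hsmall] with ε h1 h2
    simp only [ha0, zero_mul, add_zero, one_mul]
    refine hmin _ (((hu.add_const_mul hv ε).const_mul (a ε)).mem_V hr ?_ ?_)
    · rw [Q_const_mul, ha, Real.sq_sqrt (by positivity)]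
      field_simp
    · have : ∫ x, (a ε * (w x + ε * z x)) ^ 2 = a ε ^ 2 * ∫ x, (w x + ε * z x) ^ 2 :=
        Q_const_mul _ _
      rw [this]
      exact h2
  rw [show (fun ε => J (fun x => a ε * (u x + ε * v x))) = _ from
    funext fun ε => J_const_mul (fun x => u x + ε * v x) (a ε)] at hloc
  have h0 := hloc.hasDerivAt_eq_zero hh
  simp [ha0] at h0
  field_simp at h0 ⊢
  linarith

theorem h1Pair_of_test {φ : ℝ → ℝ} (hφ : ContDiff ℝ ∞ φ) (hc : HasCompactSupport φ) :
    H1Pair φ (deriv φ) := by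
  have hd : Continuous (deriv φ) := hφ.continuous_deriv (by norm_cast)
  refine ⟨memLp_two_of_hasCompactSupport hφ.continuous hc,
    memLp_two_of_hasCompactSupport hd hc.deriv, fun a b => ?_⟩
  exact (intervalIntegral.integral_eq_sub_of_hasDerivAt
    (fun x _ => (hφ.differentiable (by simp) x).hasDerivAt) (hd.intervalIntegrable _ _)).symm

theorem BddL2.integral_profile_mul {u v : ℝ → ℝ} (hu : BddL2 u) (hv : BddL2 v) {c : ℝ}
    (h : (∫ x, v x * opL u x) + (1 / 2) * ∫ x, u x ^ 2 * v x = c * ∫ x, u x * v x) :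
    ∫ x, (-c * u x + u x ^ 2 / 2 + opL u x) * v x = 0 := by
  have e : ∀ x, (-c * u x + u x ^ 2 / 2 + opL u x) * v x =
      -c * (u x * v x) + ((1 / 2) * (u x ^ 2 * v x) + v x * opL u x) := fun x => by ring
  have i1 := (hu.integrable_mul hv).const_mul (-c)
  have i2 : Integrable fun x => (1 / 2) * (u x ^ 2 * v x) := by
    simpa only [sq] using ((hu.mul hu).integrable_mul hv).const_mul (1 / 2)
  have i3 := hv.integrable_mul_opL hu
  have i23 : Integrable fun x => (1 / 2) * (u x ^ 2 * v x) + v x * opL u x := i2.add i3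
  simp_rw [e]
  rw [integral_add i1 i23, integral_add i2 i3, integral_const_mul, integral_const_mul]
  linarith

/-! ### Travelling waves as distributional solutions -/

theorem BddL2.integral_opL_mul_sub_deriv {u h : ℝ → ℝ} (hu : BddL2 u) (hh : ContDiff ℝ ∞ h)
    (hc : HasCompactSupport h) :
    ∫ x, opL u x * (h x - deriv (deriv h) x) = ∫ x, u x * h x := by
  have hd : ContDiff ℝ ∞ (deriv h) := (contDiff_infty_iff_deriv.1 hh).2
  have hdd : Continuous (deriv (deriv h)) := hd.continuous_deriv (by norm_cast)
  have w1 := HasWeakDeriv.of_hasDerivAt (fun x => hasDerivAt_opL hu.memLp hu.continuous x)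
    hu.continuous_opLDeriv (deriv h) hd hc.deriv
  have w2 := HasWeakDeriv.of_hasDerivAt (fun x => hasDerivAt_opLDeriv hu.memLp hu.continuous x)
    (hu.continuous_opL.sub hu.continuous) h hh hc
  have i1 := integrable_mul_test hu.memLp_opL hh.continuous hc
  have i2 := integrable_mul_test hu.memLp_opL hdd hc.deriv.deriv
  have i3 := integrable_mul_test hu.memLp hh.continuous hc
  simp_rw [sub_mul] at w2
  rw [integral_sub i1 i3] at w2
  simp_rw [mul_sub]
  rw [integral_sub i1 i2, w1, w2]
  ring

/-- Testing the profile equation with `h - h''` gives the weak form of `(1 - ∂²)(-c u + u²/2) + u =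
0`, in which `L` no longer appears. -/
theorem BddL2.integral_profile_mul_sub_deriv {u h : ℝ → ℝ} (hu : BddL2 u) {c : ℝ}
    (hp : ∀ φ : ℝ → ℝ, ContDiff ℝ ∞ φ → HasCompactSupport φ →
      ∫ y, (-c * u y + u y ^ 2 / 2 + opL u y) * φ y = 0)
    (hh : ContDiff ℝ ∞ h) (hc : HasCompactSupport h) :
    ∫ x, ((-c * u x + u x ^ 2 / 2) * (h x - deriv (deriv h) x) + u x * h x) = 0 := by
  have hd : ContDiff ℝ ∞ (deriv h) := (contDiff_infty_iff_deriv.1 hh).2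
  have hdd : ContDiff ℝ ∞ (deriv (deriv h)) := (contDiff_infty_iff_deriv.1 hd).2
  have hφ : ContDiff ℝ ∞ fun x => h x - deriv (deriv h) x := hh.sub hdd
  have hφc : HasCompactSupport fun x => h x - deriv (deriv h) x := hc.sub hc.deriv.deriv
  have hcu := hu.continuous
  have h1 := hp _ hφ hφc
  simp_rw [add_mul _ (opL u _)] at h1
  have i1 : Integrable fun x => (-c * u x + u x ^ 2 / 2) * (h x - deriv (deriv h) x) :=
    ((by fun_prop : Continuous fun x => -c * u x + u x ^ 2 / 2).mul
      hφ.continuous).integrable_of_hasCompactSupport hφc.mul_left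
  rw [integral_add i1 (integrable_mul_test hu.memLp_opL hφ.continuous hφc),
    hu.integral_opL_mul_sub_deriv hh hc] at h1
  rwa [integral_add i1 (integrable_mul_test hu.memLp hh.continuous hc)]

/-- The derivative of `Φ` in the direction `e`. -/
def dirDeriv (e : ℝ × ℝ) (Φ : ℝ × ℝ → ℝ) (p : ℝ × ℝ) : ℝ := fderiv ℝ Φ p e

theorem contDiff_dirDeriv (e : ℝ × ℝ) {Φ : ℝ × ℝ → ℝ} (hΦ : ContDiff ℝ ∞ Φ) :
    ContDiff ℝ ∞ (dirDeriv e Φ) :=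
  (hΦ.fderiv_right (by norm_cast)).clm_apply contDiff_const

theorem hasCompactSupport_dirDeriv (e : ℝ × ℝ) {Φ : ℝ × ℝ → ℝ} (hΦ : HasCompactSupport Φ) :
    HasCompactSupport (dirDeriv e Φ) :=
  hΦ.fderiv_apply ℝ e

theorem dirDeriv_comm (e e' : ℝ × ℝ) {Φ : ℝ × ℝ → ℝ} (hΦ : ContDiff ℝ ∞ Φ) :
    dirDeriv e (dirDeriv e' Φ) = dirDeriv e' (dirDeriv e Φ) := by
  have hd : Differentiable ℝ (fderiv ℝ Φ) :=
    (hΦ.fderiv_right (m := ∞) (by norm_cast)).differentiable (by simp)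
  have key : ∀ a b p, dirDeriv a (dirDeriv b Φ) p = fderiv ℝ (fderiv ℝ Φ) p a b := by
    intro a b p
    unfold dirDeriv
    rw [fderiv_clm_apply (hd p) (differentiableAt_const b)]
    simp
  ext p
  rw [key, key]
  exact (hΦ.contDiffAt.isSymmSndFDerivAt (by simp; norm_cast)) e e'

theorem hasDerivAt_comp_line {Φ : ℝ × ℝ → ℝ} (hΦ : ContDiff ℝ ∞ Φ) {g : ℝ → ℝ × ℝ} {e : ℝ × ℝ}
    {s : ℝ} (hg : HasDerivAt g e s) : HasDerivAt (fun s => Φ (g s)) (dirDeriv e Φ (g s)) s :=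
  (hΦ.differentiable (by simp) (g s)).hasFDerivAt.comp_hasDerivAt s hg

theorem hasDerivAt_slice_snd {Φ : ℝ × ℝ → ℝ} (hΦ : ContDiff ℝ ∞ Φ) (t a x : ℝ) :
    HasDerivAt (fun x => Φ (t, x + a)) (dirDeriv (0, 1) Φ (t, x + a)) x :=
  hasDerivAt_comp_line hΦ ((hasDerivAt_const x t).prodMk ((hasDerivAt_id x).add_const a))

theorem hasDerivAt_slice_fst {Φ : ℝ × ℝ → ℝ} (hΦ : ContDiff ℝ ∞ Φ) (x c t : ℝ) :
    HasDerivAt (fun t => Φ (t, x + c * t)) (dirDeriv (1, c) Φ (t, x + c * t)) t :=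
  hasDerivAt_comp_line hΦ ((hasDerivAt_id t).prodMk
    (by simpa using ((hasDerivAt_id t).const_mul c).const_add x))

theorem hasCompactSupport_comp_of_leftInverse {Φ : ℝ × ℝ → ℝ} (hΦ : HasCompactSupport Φ)
    {g : ℝ → ℝ × ℝ} {k : ℝ × ℝ → ℝ} (hk : Continuous k) (h : ∀ s, k (g s) = s) :
    HasCompactSupport fun s => Φ (g s) := by
  refine HasCompactSupport.intro (hΦ.isCompact.image hk) fun s hs => ?_
  by_contra hne
  exact hs ⟨g s, subset_tsupport _ hne, h s⟩

/-! ### The moving frame -/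

theorem measurePreserving_shear (c : ℝ) :
    MeasurePreserving fun p : ℝ × ℝ => (p.1, p.2 + c * p.1) :=
  MeasurePreserving.skew_product (g := fun t x => x + c * t) (MeasurePreserving.id volume)
    (by fun_prop)
    (Eventually.of_forall fun t => (measurePreserving_add_right volume (c * t)).map_eq)

theorem integral_comp_shear (F : ℝ × ℝ → ℝ) (c : ℝ) :
    ∫ p : ℝ × ℝ, F (p.1, p.2 + c * p.1) = ∫ p, F p := by
  let e : (ℝ × ℝ) ≃ₜ (ℝ × ℝ) :=
    { toFun := fun p => (p.1, p.2 + c * p.1)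
      invFun := fun p => (p.1, p.2 - c * p.1)
      left_inv := fun p => by simp
      right_inv := fun p => by simp
      continuous_toFun := by fun_prop
      continuous_invFun := by fun_prop }
  exact (measurePreserving_shear c).integral_comp e.measurableEmbedding F

/-- The weak form of `U_t + c U_x = 0` for a merely continuous `u`: in the coordinates `(t, x - c
t)` the direction `(1, c)` becomes `∂_t`, on which `u` does not depend. -/
theorem integral_transport_eq_zero {u : ℝ → ℝ} (hu : Continuous u) {Ψ : ℝ × ℝ → ℝ}
    (hΨ : ContDiff ℝ ∞ Ψ) (hc : HasCompactSupport Ψ) (c : ℝ) :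
    ∫ p : ℝ × ℝ, u (p.2 - c * p.1) * dirDeriv (1, c) Ψ p = 0 := by
  set F : ℝ × ℝ → ℝ := fun p => u (p.2 - c * p.1) * dirDeriv (1, c) Ψ p with hF
  have hFi : Integrable F :=
    ((hu.comp (by fun_prop : Continuous fun p : ℝ × ℝ => p.2 - c * p.1)).mul
      (contDiff_dirDeriv (1, c) hΨ).continuous).integrable_of_hasCompactSupport
      (hasCompactSupport_dirDeriv _ hc).mul_left
  have hFi' : Integrable fun p : ℝ × ℝ => F (p.1, p.2 + c * p.1) :=
    (measurePreserving_shear c).integrable_comp_of_integrable hFi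
  rw [← integral_comp_shear F c, Measure.volume_eq_prod, integral_prod_symm _ hFi']
  refine integral_eq_zero_of_ae (Eventually.of_forall fun y => ?_)
  simp only [hF, add_sub_cancel_right, integral_const_mul, Pi.zero_apply]
  have hslice : ∀ {Θ : ℝ × ℝ → ℝ}, ContDiff ℝ ∞ Θ → HasCompactSupport Θ →
      Integrable fun t => Θ (t, y + c * t) := fun {Θ} h1 h2 =>
    (h1.continuous.comp (by fun_prop)).integrable_of_hasCompactSupport
      (hasCompactSupport_comp_of_leftInverse h2 (g := fun t => (t, y + c * t)) continuous_fst
        fun _ => rfl)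
  rw [integral_eq_zero_of_hasDerivAt_of_integrable (fun t => hasDerivAt_slice_fst hΨ y c t)
    (hslice (contDiff_dirDeriv _ hΨ) (hasCompactSupport_dirDeriv _ hc)) (hslice hΨ hc), mul_zero]

theorem BddL2.integral_profile_slice_eq_zero {u : ℝ → ℝ} (hu : BddL2 u) {c : ℝ}
    (hp : ∀ φ : ℝ → ℝ, ContDiff ℝ ∞ φ → HasCompactSupport φ →
      ∫ y, (-c * u y + u y ^ 2 / 2 + opL u y) * φ y = 0)
    {Θ : ℝ × ℝ → ℝ} (hΘ : ContDiff ℝ ∞ Θ) (hc : HasCompactSupport Θ) :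
    ∫ p : ℝ × ℝ, ((-c * u (p.2 - c * p.1) + u (p.2 - c * p.1) ^ 2 / 2) *
      (Θ p - dirDeriv (0, 1) (dirDeriv (0, 1) Θ) p) + u (p.2 - c * p.1) * Θ p) = 0 := by
  have hΘ1 := contDiff_dirDeriv (0, 1) hΘ
  have hΘ2 := contDiff_dirDeriv (0, 1) hΘ1
  have hc2 := hasCompactSupport_dirDeriv (0, 1) (hasCompactSupport_dirDeriv (0, 1) hc)
  have hU : Continuous fun p : ℝ × ℝ => u (p.2 - c * p.1) :=
    hu.continuous.comp (by fun_prop)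
  set F : ℝ × ℝ → ℝ := fun p => (-c * u (p.2 - c * p.1) + u (p.2 - c * p.1) ^ 2 / 2) *
    (Θ p - dirDeriv (0, 1) (dirDeriv (0, 1) Θ) p) + u (p.2 - c * p.1) * Θ p with hF
  have hFc : Continuous F :=
    (((continuous_const.mul hU).add ((hU.pow 2).div_const 2)).mul
      (hΘ.continuous.sub hΘ2.continuous)).add (hU.mul hΘ.continuous)
  have hFi : Integrable F := hFc.integrable_of_hasCompactSupport
    ((hc.sub hc2).mul_left.add hc.mul_left)
  have hFi' : Integrable fun p : ℝ × ℝ => F (p.1, p.2 + c * p.1) :=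
    (measurePreserving_shear c).integrable_comp_of_integrable hFi
  rw [← integral_comp_shear F c, Measure.volume_eq_prod, integral_prod _ hFi']
  refine integral_eq_zero_of_ae (Eventually.of_forall fun t => ?_)
  have hd1 : deriv (fun y => Θ (t, y + c * t)) = fun y => dirDeriv (0, 1) Θ (t, y + c * t) :=
    funext fun y => (hasDerivAt_slice_snd hΘ t (c * t) y).deriv
  have hd2 : deriv (fun y => dirDeriv (0, 1) Θ (t, y + c * t)) =
      fun y => dirDeriv (0, 1) (dirDeriv (0, 1) Θ) (t, y + c * t) :=
    funext fun y => (hasDerivAt_slice_snd hΘ1 t (c * t) y).deriv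
  have h := hu.integral_profile_mul_sub_deriv hp (h := fun y => Θ (t, y + c * t))
    (hΘ.comp (contDiff_const.prodMk (contDiff_id.add contDiff_const)))
    (hasCompactSupport_comp_of_leftInverse hc (g := fun y => (t, y + c * t))
      (k := fun p => p.2 - c * t) (by fun_prop) fun _ => by simp)
  rw [hd1, hd2] at h
  simpa only [hF, add_sub_cancel_right, Pi.zero_apply] using h

theorem BddL2.isWeakSolution {u : ℝ → ℝ} (hu : BddL2 u) {c : ℝ}
    (hp : ∀ φ : ℝ → ℝ, ContDiff ℝ ∞ φ → HasCompactSupport φ →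
      ∫ y, (-c * u y + u y ^ 2 / 2 + opL u y) * φ y = 0) :
    IsWeakSolution fun t x => u (x - c * t) := by
  have hU : Continuous fun p : ℝ × ℝ => u (p.2 - c * p.1) :=
    hu.continuous.comp (by fun_prop)
  refine ⟨hU.locallyIntegrable, (hU.pow 2).locallyIntegrable, fun φ hφ hφc => ?_⟩
  set Φ : ℝ × ℝ → ℝ := fun p => φ p.1 p.2 with hΦ
  have hX : ∀ {Θ : ℝ × ℝ → ℝ}, ContDiff ℝ ∞ Θ → ∀ t,
      deriv (fun x => Θ (t, x)) = fun x => dirDeriv (0, 1) Θ (t, x) := fun {Θ} hΘ t =>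
    funext fun x => by simpa using (hasDerivAt_slice_snd hΘ t 0 x).deriv
  have hT : ∀ t x, deriv (fun s => φ s x) t = dirDeriv (1, 0) Φ (t, x) := fun t x => by
    simpa using (hasDerivAt_slice_fst hφ x 0 t).deriv
  have c1 := contDiff_dirDeriv (0, 1) hφ
  have c2 := contDiff_dirDeriv (0, 1) c1
  have c3 := contDiff_dirDeriv (0, 1) c2
  have cT := contDiff_dirDeriv (1, 0) hφ
  have k1 := hasCompactSupport_dirDeriv (0, 1) hφc
  have k2 := hasCompactSupport_dirDeriv (0, 1) k1
  have k3 := hasCompactSupport_dirDeriv (0, 1) k2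
  have hX1 : ∀ t, deriv (φ t) = fun x => dirDeriv (0, 1) Φ (t, x) := fun t => hX hφ t
  have hX3 : ∀ t x, iteratedDeriv 3 (φ t) x =
      dirDeriv (0, 1) (dirDeriv (0, 1) (dirDeriv (0, 1) Φ)) (t, x) := fun t x => by
    rw [iteratedDeriv_eq_iterate]
    simp only [Function.iterate_succ, Function.iterate_zero, Function.comp_apply, id_eq]
    rw [hX1, hX c1, hX c2]
  have hXT : ∀ t x, iteratedDeriv 2 (fun x => deriv (fun s => φ s x) t) x =
      dirDeriv (1, 0) (dirDeriv (0, 1) (dirDeriv (0, 1) Φ)) (t, x) := fun t x => by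
    rw [iteratedDeriv_eq_iterate]
    simp only [Function.iterate_succ, Function.iterate_zero, Function.comp_apply, id_eq, hT]
    rw [hX cT, hX (contDiff_dirDeriv (0, 1) cT), dirDeriv_comm (0, 1) (1, 0) hφ,
      dirDeriv_comm (0, 1) (1, 0) c1]
  -- The transport identity tested with `Ψ = (1 - ∂ₓ²)Φ` and the profile identity tested with `∂ₓΦ`
  -- add up to the required integrand; the terms in `c` cancel.
  set Ψ : ℝ × ℝ → ℝ := fun p => Φ p - dirDeriv (0, 1) (dirDeriv (0, 1) Φ) p with hΨ
  have hΨs : ContDiff ℝ ∞ Ψ := hφ.sub c2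
  have hΨc : HasCompactSupport Ψ := hφc.sub k2
  have hΨd : ∀ p, dirDeriv (1, c) Ψ p =
      dirDeriv (1, 0) Φ p - dirDeriv (1, 0) (dirDeriv (0, 1) (dirDeriv (0, 1) Φ)) p +
      c * (dirDeriv (0, 1) Φ p - dirDeriv (0, 1) (dirDeriv (0, 1) (dirDeriv (0, 1) Φ)) p) := by
    intro p
    have hfd : fderiv ℝ Ψ p = fderiv ℝ Φ p - fderiv ℝ (dirDeriv (0, 1) (dirDeriv (0, 1) Φ)) p :=
      fderiv_fun_sub (hφ.differentiable (by simp) p) (c2.differentiable (by simp) p)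
    have he : ((1 : ℝ), c) = (1, 0) + c • ((0 : ℝ), (1 : ℝ)) := by simp
    unfold dirDeriv at hfd ⊢
    rw [hfd, he, map_add, map_smul]
    simp only [sub_apply, smul_eq_mul]
  have h1 := integral_transport_eq_zero hu.continuous hΨs hΨc c
  have h2 := hu.integral_profile_slice_eq_zero hp c1 k1
  have i1 : Integrable fun p : ℝ × ℝ => u (p.2 - c * p.1) * dirDeriv (1, c) Ψ p :=
    (hU.mul (contDiff_dirDeriv (1, c) hΨs).continuous).integrable_of_hasCompactSupport
      (hasCompactSupport_dirDeriv _ hΨc).mul_left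
  have i2 : Integrable fun p : ℝ × ℝ => (-c * u (p.2 - c * p.1) + u (p.2 - c * p.1) ^ 2 / 2) *
      (dirDeriv (0, 1) Φ p - dirDeriv (0, 1) (dirDeriv (0, 1) (dirDeriv (0, 1) Φ)) p) +
      u (p.2 - c * p.1) * dirDeriv (0, 1) Φ p :=
    ((((continuous_const.mul hU).add ((hU.pow 2).div_const 2)).mul
      (c1.continuous.sub c3.continuous)).add
      (hU.mul c1.continuous)).integrable_of_hasCompactSupport ((k1.sub k3).mul_left.add k1.mul_left)
  have h12 := integral_add i1 i2
  rw [h1, h2, add_zero] at h12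
  rw [← h12]
  congr 1
  ext p
  rw [hT, hXT, hX1, hX3, hΨd]
  ring

/-- Null sets of the line pull back to null sets of the plane under `(t, x) ↦ x - c t`, a shear
followed by a projection. -/
theorem IsWeakSolution.congr_ae {u v : ℝ → ℝ} {c : ℝ} (huv : u =ᵐ[volume] v)
    (h : IsWeakSolution fun t x => v (x - c * t)) : IsWeakSolution fun t x => u (x - c * t) := by
  have hqmp : Measure.QuasiMeasurePreserving fun p : ℝ × ℝ => p.2 - c * p.1 := by
    have h1 := Measure.quasiMeasurePreserving_snd.comp
      (measurePreserving_shear (-c)).quasiMeasurePreserving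
    convert! h1 using 1
    ext p
    simp only [Function.comp]; ring
  have hae : (fun p : ℝ × ℝ => u (p.2 - c * p.1)) =ᵐ[volume] fun p => v (p.2 - c * p.1) :=
    hqmp.ae_eq_comp huv
  obtain ⟨h1, h2, h3⟩ := h
  refine ⟨h1.congr hae.symm, h2.congr (hae.mono fun p hp => by simp only [hp]), fun φ hφ hc => ?_⟩
  refine Eq.trans (integral_congr_ae ?_) (h3 φ hφ hc)
  filter_upwards [hae] with p hp
  simp only [hp]

/-! ### Minimizers are solitary waves -/

theorem exists_isSolitaryWave {q r : ℝ} (hq : 0 < q) (hr : 0 < r) {u : ℝ → ℝ} (hu : u ∈ G q r) :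
    ∃ c : ℝ, IsLagrangeMultiplier u (-(c / 2)) ∧ IsSolitaryWave u c := by
  obtain ⟨huV, hmin⟩ := hu
  obtain ⟨y, w, huy, hy, hQ, hlt, -⟩ := exists_h1Pair_of_mem_V hr huV
  have hymin : ∀ z ∈ V q r, J y ≤ J z := fun z hz => J_congr huy ▸ isMinOn_iff.1 hmin z hz
  have hEL := fun v z (hv : H1Pair v z) => hy.euler_lagrange hq hr hQ hlt hymin hv
  set c := ((∫ x, y x * opL y x) + (1 / 2) * ∫ x, y x ^ 3) / q
  have hprofile : ∀ φ : ℝ → ℝ, ContDiff ℝ ∞ φ → HasCompactSupport φ →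
      ∫ x, (-c * y x + y x ^ 2 / 2 + opL y x) * φ x = 0 := fun φ hφ hc =>
    hy.bddL2.integral_profile_mul (h1Pair_of_test hφ hc).bddL2 (hEL _ _ (h1Pair_of_test hφ hc))
  refine ⟨c, fun v hv => ?_, huV.1, fun h0 => ?_, ⟨y, hy.continuous, huy, hy.tendsto_zero⟩,
    fun φ hφ hc => ?_, IsWeakSolution.congr_ae huy (hy.bddL2.isWeakSolution hprofile)⟩
  · obtain ⟨v', hvv', hv'⟩ := hv.exists_h1Pair
    have hsum : ∀ ε : ℝ, (fun x => u x + ε * v x) =ᵐ[volume] fun x => y x + ε * v' x := fun ε => by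
      filter_upwards [huy, hvv'] with x h1 h2
      rw [h1, h2]
    simp_rw [fun ε => J_congr (hsum ε), fun ε => Q_congr (hsum ε)]
    refine ⟨_, _, hy.bddL2.hasDerivAt_J hv'.bddL2, hy.bddL2.hasDerivAt_Q hv'.bddL2, ?_⟩
    linarith [hEL _ _ hv']
  · have : Q u = 0 := by rw [Q_congr h0]; simp [Q]
    rw [huV.2.1] at this
    exact hq.ne' this
  · rw [← hprofile φ hφ hc]
    refine integral_congr_ae (huy.mono fun x hx => ?_)
    simp only [hx, opL_congr huy]

end FornbergWhitham

end

theorem theorem2p1 :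
    (∀ κ : ℝ, 0 < κ → κ < 1 → ∃ r₀ : ℝ, 0 < r₀ ∧ ∀ r : ℝ, 0 < r → r < r₀ →
      ∀ q : ℝ, 0 < q → q ≤ κ * r ^ 2 → (FornbergWhitham.G q r).Nonempty) ∧
    (∀ q r : ℝ, 0 < q → 0 < r → ∀ u ∈ FornbergWhitham.G q r, ∃ c : ℝ,
      FornbergWhitham.IsLagrangeMultiplier u (-(c / 2)) ∧
      FornbergWhitham.IsSolitaryWave u c) :=
  ⟨fun _ h0 h1 => FornbergWhitham.exists_forall_G_nonempty h0 h1,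
    fun _ _ hq hr _ hu => FornbergWhitham.exists_isSolitaryWave hq hr hu⟩
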